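/- Let $k$ be a field. A positively graded $k$-algebra is a commutative $\mathbb N$-graded $k$-algebra $A=\bigoplus_{i\ge 0}A_i$ with $A_0=k$; write $\mathfrak m=\bigoplus_{i>0}A_i$ for its homogeneous maximal ideal. It is standard graded if it is generated as a $k$-algebra by $A_1$. Cohen–Macaulay rings are Noetherian by definition. A Cohen–Macaulay standard graded $k$-algebra $A$ of dimension $d$ has minimal multiplicity if $e(A)=\operatorname{edim}A-d+1$, where $e(A)=\lim_{n\to\infty} d!\,\dim_k(A/\mathfrak m^n)/n^d$ is its multiplicity and $\operatorname{edim}A=\dim_k \mathfrak m/\mathfrak m^2$. Let $A\subsetneq B$ be a proper integral extension of positively graded Cohen–Macaulay $k$-algebras which is homogeneous, that is, $A$ is a $k$-subalgebra of $B$ with $A_i\subset B_i$ for all $i$. If $A$ is standard graded of minimal multiplicity, then the $A$-module $B/A$ is maximal Cohen–Macaulay, that is, it is a finitely generated Cohen–Macaulay $A$-module (for every maximal ideal $\mathfrak p$ of $A$ in the support of $B/A$, the depth of $(B/A)_{\mathfrak p}$ equals its dimension) and $\dim B/A=\dim A$. -/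

import Mathlib

open Filter Topology

/-- The depth of a module `M` over a local ring `R`: the supremum of the lengths of the
`M`-regular sequences of elements of the maximal ideal. -/
noncomputable def localDepth (R M : Type*) [CommRing R] [IsLocalRing R]
    [AddCommGroup M] [Module R M] : ℕ∞ :=
  ⨆ (rs : List R) (_ : RingTheory.Sequence.IsRegular M rs ∧
    ∀ r ∈ rs, r ∈ IsLocalRing.maximalIdeal R), (rs.length : ℕ∞)

/-- A module `M` over a (Noetherian) ring `R` is Cohen–Macaulay if it is finitely generated and
`depth M_p = dim M_p` for every maximal ideal `p` in the support of `M`. -/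
def IsCohenMacaulayModule (R M : Type*) [CommRing R] [AddCommGroup M] [Module R M] : Prop :=
  Module.Finite R M ∧
    ∀ p : MaximalSpectrum R, p.toPrimeSpectrum ∈ Module.support R M →
      (localDepth (Localization.AtPrime p.asIdeal)
        (LocalizedModule p.asIdeal.primeCompl M) : WithBot ℕ∞) =
      Module.supportDim (Localization.AtPrime p.asIdeal)
        (LocalizedModule p.asIdeal.primeCompl M)

/-- A ring is Cohen–Macaulay if it is Noetherian and Cohen–Macaulay as a module over itself. -/
def IsCohenMacaulayRing (R : Type*) [CommRing R] : Prop :=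
  IsNoetherianRing R ∧ IsCohenMacaulayModule R R

/-- A maximal Cohen–Macaulay module: a Cohen–Macaulay module whose dimension is that of the ring.
(The zero module has dimension `⊥`, so it is not maximal Cohen–Macaulay over a nonzero ring.) -/
def IsMaximalCohenMacaulayModule (R M : Type*) [CommRing R] [AddCommGroup M] [Module R M] :
    Prop :=
  IsCohenMacaulayModule R M ∧ Module.supportDim R M = ringKrullDim R

/-- An `ℕ`-graded `k`-algebra is positively graded if its degree zero part is `k`. -/
def IsPositivelyGraded {k A : Type*} [Field k] [CommRing A] [Algebra k A]
    (𝒜 : ℕ → Submodule k A) [GradedAlgebra 𝒜] : Prop :=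
  Function.Bijective (algebraMap k (𝒜 0))

/-- A positively graded `k`-algebra is standard graded if it is generated by its linear forms
(the finiteness of their number comes from Noetherianity). -/
def IsStandardGraded {k A : Type*} [Field k] [CommRing A] [Algebra k A]
    (𝒜 : ℕ → Submodule k A) [GradedAlgebra 𝒜] : Prop :=
  IsPositivelyGraded 𝒜 ∧ Algebra.adjoin k (𝒜 1 : Set A) = ⊤

/-- The embedding dimension `dim_k (𝔪 / 𝔪²)`, where `𝔪` is the homogeneous maximal ideal. -/
noncomputable def gradedEmbDim {k A : Type*} [Field k] [CommRing A] [Algebra k A]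
    (𝒜 : ℕ → Submodule k A) [GradedAlgebra 𝒜] : ℕ :=
  Module.finrank k (HomogeneousIdeal.irrelevant 𝒜).toIdeal.Cotangent

/-- `A` has (Krull) dimension `d` and multiplicity `e`, where the (Hilbert–Samuel) multiplicity
is the limit of `d! · dim_k (A / 𝔪 ^ n) / n ^ d`, for `𝔪` the homogeneous maximal ideal. -/
def HasDimAndMultiplicity {k A : Type*} [Field k] [CommRing A] [Algebra k A]
    (𝒜 : ℕ → Submodule k A) [GradedAlgebra 𝒜] (d : ℕ) (e : ℝ) : Prop :=
  ringKrullDim A = d ∧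
    Tendsto (fun n : ℕ => (d.factorial : ℝ) *
      (Module.finrank k (A ⧸ (HomogeneousIdeal.irrelevant 𝒜).toIdeal ^ n) : ℝ) / (n : ℝ) ^ d)
      atTop (𝓝 e)

/-- Minimal multiplicity: `e(A) = edim A - dim A + 1`. -/
def HasMinimalMultiplicity {k A : Type*} [Field k] [CommRing A] [Algebra k A]
    (𝒜 : ℕ → Submodule k A) [GradedAlgebra 𝒜] : Prop :=
  ∃ d : ℕ, HasDimAndMultiplicity 𝒜 d ((gradedEmbDim 𝒜 : ℝ) - d + 1)

/-!
The module `B/A` is maximal Cohen–Macaulay because, up to extension of the base field, it is free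
over a polynomial ring in `d = dim A` variables.

Suppose first that the base field `K` is algebraically closed. Both `A` and `B` have depth `d` along
the ideal generated by the linear forms of `A`, since `A` is standard graded and `B` is integral
over `A`. Prime avoidance over the infinite field `K` gives linear forms `θ₁, …, θ_d` of `A` that
are regular on `A` and on `B` simultaneously (`HasDepth.exists_generic_isWeaklyRegular`). A
`K`-basis of `A/θA` lifts to elements of `A` independent over `S = K[θ]`, so the growth of the
Hilbert function bounds the length of `A/θA` by the multiplicity `e(A)`. The part of `A/θA` in
degrees `0` and `1` already has dimension at least `1 + edim A - d = e(A)`; hence `A/θA` vanishes in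
degrees at least two (`GradedAlgebra.mem_span_linear_of_two_le`). The map `A/θA → B/θB` is then
injective, because the degree one part of `θB` is just the span of the `θᵢ`. So a
homogeneous `S`-basis of `A` extends to a homogeneous `S`-basis of `B`, and `B/A` is `S`-free
(`GradedAlgebra.hasDepth_quotient_range`). By the Nullstellensatz every maximal ideal of `A`
contains a sequence `θᵢ - aᵢ` with `aᵢ` in `K`, which is regular on every flat `S`-module.

Over an arbitrary field `k`, one passes to `K ⊗ A` and `K ⊗ B`, where `K` is the algebraic closure.
These rings are not known in advance to be Cohen–Macaulay, but the depth along the ideal of linear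
forms ascends by flatness (`GradedAlgebra.hasDepth_span_linearFormsMap`), and the depth of `B/A`
at the maximal ideals of `A` descends along the flat extension from `A` to `K ⊗ A`
(`HasDepth.of_flat`).

Depth is handled through `HasDepth I n M`, the existence of a weakly `M`-regular sequence of
length `n` in `I`; its basic properties rest on the exchange lemma `HasDepth.quotSMulTop`.
-/

open RingTheory.Sequence Pointwise TensorProduct

/-! ### Depth of an ideal on a module -/

/-- `HasDepth I n M`: the ideal `I` contains a weakly `M`-regular sequence of length `n`. The
sequence is only weakly regular, so the zero module has every depth. -/
def HasDepth {R : Type*} [CommRing R] (I : Ideal R) (n : ℕ) (M : Type*) [AddCommGroup M]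
    [Module R M] : Prop :=
  ∃ rs : List R, rs.length = n ∧ (∀ r ∈ rs, r ∈ I) ∧ IsWeaklyRegular M rs

theorem quotSMulTop_mk_eq_zero_iff {R M : Type*} [CommRing R] [AddCommGroup M] [Module R M]
    {x : R} {u : M} :
    (Submodule.Quotient.mk u : QuotSMulTop x M) = 0 ↔ ∃ v, x • v = u := by
  rw [Submodule.Quotient.mk_eq_zero, Submodule.mem_smul_pointwise_iff_exists]
  simp

theorem isSMulRegular_quotSMulTop_swap {R M : Type*} [CommRing R] [AddCommGroup M] [Module R M]
    {x z : R} (hx : IsSMulRegular M x) (hz : IsSMulRegular (QuotSMulTop x M) z) :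
    IsSMulRegular (QuotSMulTop z M) x := by
  rw [isSMulRegular_iff_right_eq_zero_of_smul] at hx hz ⊢
  intro m hm
  obtain ⟨m, rfl⟩ := Submodule.Quotient.mk_surjective _ m
  rw [← Submodule.Quotient.mk_smul, quotSMulTop_mk_eq_zero_iff] at hm
  obtain ⟨n, hn⟩ := hm
  have h1 := hz (Submodule.Quotient.mk n) (by
    rw [← Submodule.Quotient.mk_smul, quotSMulTop_mk_eq_zero_iff]; exact ⟨m, hn.symm⟩)
  obtain ⟨n', rfl⟩ := quotSMulTop_mk_eq_zero_iff.1 h1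
  refine quotSMulTop_mk_eq_zero_iff.2 ⟨n', ?_⟩
  rw [smul_comm, ← sub_eq_zero, ← smul_sub] at hn
  exact sub_eq_zero.1 (hx _ hn)

namespace HasDepth

section Basic

variable {R : Type*} [CommRing R] {I J : Ideal R} {n : ℕ}
  {M N : Type*} [AddCommGroup M] [Module R M] [AddCommGroup N] [Module R N]

theorem zero : HasDepth I 0 M := ⟨[], rfl, by simp, by simp⟩

theorem succ_iff : HasDepth I (n + 1) M ↔
    ∃ x ∈ I, IsSMulRegular M x ∧ HasDepth I n (QuotSMulTop x M) := by
  constructor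
  · rintro ⟨rs, hl, hm, hr⟩
    match rs, hl, hm, hr with
    | x :: rs, hl, hm, hr =>
      rw [isWeaklyRegular_cons_iff] at hr
      exact ⟨x, hm x (by simp), hr.1, rs, by simpa using hl, fun r h => hm r (by simp [h]), hr.2⟩
  · rintro ⟨x, hx, hxr, rs, hl, hm, hr⟩
    refine ⟨x :: rs, by simp [hl], ?_, (isWeaklyRegular_cons_iff ..).2 ⟨hxr, hr⟩⟩
    intro r h
    rcases List.mem_cons.1 h with rfl | h
    exacts [hx, hm r h]

theorem of_le {m : ℕ} (h : HasDepth I n M) (hm : m ≤ n) : HasDepth I m M := by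
  induction m generalizing n M with
  | zero => exact zero
  | succ m ih =>
    obtain ⟨n, rfl⟩ : ∃ n', n = n' + 1 := ⟨n - 1, by omega⟩
    obtain ⟨x, hx, hr, h⟩ := succ_iff.1 h
    exact succ_iff.2 ⟨x, hx, hr, ih h (by omega)⟩

theorem congr (e : M ≃ₗ[R] N) (h : HasDepth I n M) : HasDepth I n N := by
  obtain ⟨rs, hl, hm, hr⟩ := h
  exact ⟨rs, hl, hm, (e.isWeaklyRegular_congr rs).1 hr⟩

theorem quot_comm (x y : R) (h : HasDepth I n (QuotSMulTop x (QuotSMulTop y M))) :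
    HasDepth I n (QuotSMulTop y (QuotSMulTop x M)) :=
  h.congr (QuotSMulTop.congr x (QuotSMulTop.equivQuotTensor y M) ≪≫ₗ
    (QuotSMulTop.tensorQuotSMulTopEquivQuotSMulTop x _ M).symm ≪≫ₗ
    (QuotSMulTop.equivQuotTensor y _).symm)

theorem eq_zero_of_smul_eq_zero (h : HasDepth I (n + 1) M) (u : M) (hu : ∀ r ∈ I, r • u = 0) :
    u = 0 := by
  obtain ⟨x, hx, hr, -⟩ := succ_iff.1 h
  exact (isSMulRegular_iff_right_eq_zero_of_smul.1 hr) u (hu x hx)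

theorem map_of_isBaseChange {S : Type*} [CommRing S] [Algebra R S] [Module.Flat R S] [Module S N]
    [IsScalarTower R S N] {f : M →ₗ[R] N} (hf : IsBaseChange S f) (h : HasDepth I n M) :
    HasDepth (I.map (algebraMap R S)) n N := by
  obtain ⟨rs, hl, hm, hr⟩ := h
  refine ⟨rs.map (algebraMap R S), by simpa using hl, ?_, hr.of_flat_of_isBaseChange hf⟩
  intro r h
  obtain ⟨a, ha, rfl⟩ := List.mem_map.1 h
  exact Ideal.mem_map_of_mem _ (hm a ha)

end Basic

section Noetherian

variable {R : Type*} [CommRing R] [IsNoetherianRing R] {I J : Ideal R} {n : ℕ}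
  {M : Type*} [AddCommGroup M] [Module R M] [Module.Finite R M]

/-- By prime avoidance, an ideal that annihilates no nonzero element of a finite module contains an
element regular on it. -/
theorem exists_isSMulRegular_of_forall_eq_zero (hM : ∀ u : M, (∀ r ∈ I, r • u = 0) → u = 0) :
    ∃ x ∈ I, IsSMulRegular M x := by
  by_contra! hcon
  obtain ⟨p, hp, hle⟩ := (I.subset_union_prime_finite
    (associatedPrimes.finite R M) (f := id) ⊥ ⊥ (fun p hp _ _ => hp.isPrime)).1 (by
      intro x hx
      have : x ∈ ({r : R | IsSMulRegular M r}ᶜ : Set R) := hcon x hx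
      rw [← biUnion_associatedPrimes_eq_compl_regular] at this
      exact this)
  obtain ⟨hp', u, hu⟩ := isAssociatedPrime_iff.1 hp
  have hu0 : u = 0 := hM u fun r hr => by
    have : r ∈ p := hle hr
    rwa [hu, Submodule.mem_colon_singleton, Submodule.mem_bot] at this
  exact hp'.ne_top (by rw [hu, hu0]; ext; simp)

/-- The exchange step: for elements `x`, `y` of `I` regular on `M`, if `I` annihilates nothing in
`M/xM`, then it annihilates nothing in `M/yM`. -/
theorem eq_zero_of_smul_eq_zero_exchange {R : Type*} [CommRing R] {I : Ideal R}
    {M : Type*} [AddCommGroup M] [Module R M] {x y : R} (hx : IsSMulRegular M x) (hxI : x ∈ I)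
    (hy : IsSMulRegular M y)
    (h : ∀ u : QuotSMulTop x M, (∀ r ∈ I, r • u = 0) → u = 0)
    (u : QuotSMulTop y M) (hu : ∀ r ∈ I, r • u = 0) : u = 0 := by
  obtain ⟨u, rfl⟩ := Submodule.Quotient.mk_surjective _ u
  have hu' : ∀ r ∈ I, ∃ v, y • v = r • u := fun r hr => by
    have := hu r hr
    rwa [← Submodule.Quotient.mk_smul, quotSMulTop_mk_eq_zero_iff] at this
  obtain ⟨v, hv⟩ := hu' x hxI
  have h1 : (Submodule.Quotient.mk v : QuotSMulTop x M) = 0 := h _ fun r hr => by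
    rw [← Submodule.Quotient.mk_smul, quotSMulTop_mk_eq_zero_iff]
    obtain ⟨w, hw⟩ := hu' r hr
    refine ⟨w, hy ?_⟩
    change y • x • w = y • r • v
    rw [smul_comm, hw, smul_comm y, hv, smul_comm]
  obtain ⟨t, rfl⟩ := quotSMulTop_mk_eq_zero_iff.1 h1
  refine quotSMulTop_mk_eq_zero_iff.2 ⟨t, hx ?_⟩
  change x • y • t = x • u
  rw [← hv, smul_comm]

/-- Depth drops by exactly one modulo any regular element of the ideal. -/
theorem quotSMulTop (h : HasDepth I (n + 1) M) {y : R} (hyI : y ∈ I) (hy : IsSMulRegular M y) :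
    HasDepth I n (QuotSMulTop y M) := by
  induction n generalizing M y with
  | zero => exact zero
  | succ n ih =>
    obtain ⟨x, hxI, hx, hd⟩ := succ_iff.1 h
    obtain ⟨z, hzI, hz⟩ := exists_isSMulRegular_of_forall_eq_zero (I := I)
      (M := QuotSMulTop x M × QuotSMulTop y M) (by
        intro u hu
        ext1
        · exact hd.eq_zero_of_smul_eq_zero _ fun r hr => congrArg Prod.fst (hu r hr)
        · exact eq_zero_of_smul_eq_zero_exchange hx hxI hy hd.eq_zero_of_smul_eq_zero _
            fun r hr => congrArg Prod.snd (hu r hr))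
    have hzx : IsSMulRegular (QuotSMulTop x M) z := fun a b hab =>
      congrArg Prod.fst (@hz (a, 0) (b, 0) (Prod.ext hab rfl))
    have hzy : IsSMulRegular (QuotSMulTop y M) z := fun a b hab =>
      congrArg Prod.snd (@hz (0, a) (0, b) (Prod.ext rfl hab))
    have h1 : HasDepth I (n + 1) (QuotSMulTop z M) :=
      succ_iff.2 ⟨x, hxI, isSMulRegular_quotSMulTop_swap hx hzx, quot_comm _ _ (ih hd hzI hzx)⟩
    exact succ_iff.2 ⟨z, hzI, hzy,
      quot_comm _ _ (ih h1 hyI (isSMulRegular_quotSMulTop_swap hy hzy))⟩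

/-- Depth depends only on the radical: a regular sequence may be replaced by powers one term at a
time, since passing to the quotient by any regular element lowers the depth by one. -/
theorem of_le_radical (h : HasDepth J n M) (hJ : J ≤ I.radical) : HasDepth I n M := by
  induction n generalizing M with
  | zero => exact zero
  | succ n ih =>
    obtain ⟨x, hxJ, hx, hd⟩ := succ_iff.1 h
    obtain ⟨N, hN⟩ := hJ hxJ
    have hN' : x ^ (N + 1) ∈ I := by rw [pow_succ]; exact I.mul_mem_right _ hN
    exact succ_iff.2 ⟨x ^ (N + 1), hN', hx.pow _,
      ih (h.quotSMulTop (J.pow_mem_of_mem hxJ _ (by omega)) (hx.pow _))⟩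

/-- A regular element can be chosen simultaneously for two modules (possibly over different
rings) inside a vector space of candidates over an infinite field. -/
theorem exists_generic_isSMulRegular {K V R' : Type*} [Field K] [Infinite K] [AddCommGroup V]
    [Module K V] [CommRing R'] [IsNoetherianRing R'] [Algebra K R] [Algebra K R']
    (φ : V →ₗ[K] R) (φ' : V →ₗ[K] R')
    {M' : Type*} [AddCommGroup M'] [Module R' M'] [Module.Finite R' M']
    (h : HasDepth (Ideal.span (Set.range φ)) (n + 1) M)
    (h' : HasDepth (Ideal.span (Set.range φ')) (n + 1) M') :
    ∃ v, IsSMulRegular M (φ v) ∧ IsSMulRegular M' (φ' v) := by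
  classical
  -- the preimages of the associated primes are finitely many proper subspaces, which cannot cover `V`
  let s : Set (Subspace K V) :=
    (fun p : Ideal R => (p.restrictScalars K).comap φ) '' associatedPrimes R M ∪
    (fun p : Ideal R' => (p.restrictScalars K).comap φ') '' associatedPrimes R' M'
  have hs : s.Finite := ((associatedPrimes.finite R M).image _).union
    ((associatedPrimes.finite R' M').image _)
  have htop : (⊤ : Subspace K V) ∉ hs.toFinset := by
    rw [Set.Finite.mem_toFinset]
    rintro (⟨p, hp, hpt⟩ | ⟨p, hp, hpt⟩)
    · obtain ⟨x, hxI, hx, -⟩ := succ_iff.1 h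
      have hle : Ideal.span (Set.range φ) ≤ p := Ideal.span_le.2 (by
        rintro _ ⟨v, rfl⟩
        have : v ∈ (p.restrictScalars K).comap φ := hpt.ge Submodule.mem_top
        exact this)
      have : x ∈ ({r : R | IsSMulRegular M r}ᶜ : Set R) := by
        rw [← biUnion_associatedPrimes_eq_compl_regular]
        exact Set.mem_biUnion hp (hle hxI)
      exact this hx
    · obtain ⟨x, hxI, hx, -⟩ := succ_iff.1 h'
      have hle : Ideal.span (Set.range φ') ≤ p := Ideal.span_le.2 (by
        rintro _ ⟨v, rfl⟩
        have : v ∈ (p.restrictScalars K).comap φ' := hpt.ge Submodule.mem_top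
        exact this)
      have : x ∈ ({r : R' | IsSMulRegular M' r}ᶜ : Set R') := by
        rw [← biUnion_associatedPrimes_eq_compl_regular]
        exact Set.mem_biUnion hp (hle hxI)
      exact this hx
  have hne := Subspace.biUnion_ne_univ_of_top_notMem htop
  obtain ⟨v, hv⟩ := (Set.ne_univ_iff_exists_notMem _).1 hne
  simp only [Set.mem_iUnion, not_exists, Set.Finite.mem_toFinset] at hv
  refine ⟨v, ?_, ?_⟩
  · by_contra hcon
    have : φ v ∈ ({r : R | IsSMulRegular M r}ᶜ : Set R) := hcon
    rw [← biUnion_associatedPrimes_eq_compl_regular] at this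
    obtain ⟨p, hp, hvp⟩ := Set.mem_iUnion₂.1 this
    exact hv _ (Or.inl ⟨p, hp, rfl⟩) hvp
  · by_contra hcon
    have : φ' v ∈ ({r : R' | IsSMulRegular M' r}ᶜ : Set R') := hcon
    rw [← biUnion_associatedPrimes_eq_compl_regular] at this
    obtain ⟨p, hp, hvp⟩ := Set.mem_iUnion₂.1 this
    exact hv _ (Or.inr ⟨p, hp, rfl⟩) hvp

/-- Over an infinite field, a generic sequence from a space of candidates generating the ideal is
regular, simultaneously on two modules. -/
theorem exists_generic_isWeaklyRegular {K V R' : Type*} [Field K] [Infinite K] [AddCommGroup V]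
    [Module K V] [CommRing R'] [IsNoetherianRing R'] [Algebra K R] [Algebra K R']
    (φ : V →ₗ[K] R) (φ' : V →ₗ[K] R')
    {M' : Type*} [AddCommGroup M'] [Module R' M'] [Module.Finite R' M']
    (h : HasDepth (Ideal.span (Set.range φ)) n M)
    (h' : HasDepth (Ideal.span (Set.range φ')) n M') :
    ∃ vs : List V, vs.length = n ∧ IsWeaklyRegular M (vs.map φ) ∧
      IsWeaklyRegular M' (vs.map φ') := by
  induction n generalizing M M' with
  | zero => exact ⟨[], rfl, by simp, by simp⟩
  | succ n ih =>
    obtain ⟨v, hv, hv'⟩ := exists_generic_isSMulRegular φ φ' h h'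
    obtain ⟨vs, hl, hr, hr'⟩ := ih
      (h.quotSMulTop (Ideal.subset_span ⟨v, rfl⟩) hv)
      (h'.quotSMulTop (Ideal.subset_span ⟨v, rfl⟩) hv')
    exact ⟨v :: vs, by simp [hl], by simp [hv, hr], by simp [hv', hr']⟩

/-- Depth at a maximal ideal `p` descends along a flat extension `S`. If `p` annihilated a nonzero
`u` in `M`, then `1 ⊗ u` would be annihilated by `pS`, and an associated prime of `S ⊗ M` above
`pS` would have depth zero; hence `p` contains an element regular on `M`, and one can induct. -/
theorem of_flat (S : Type*) [CommRing S] [IsNoetherianRing S] [Algebra R S] [Module.Flat R S]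
    (p : Ideal R) [hpm : p.IsMaximal] (hp : p.map (algebraMap R S) ≠ ⊤)
    (h : ∀ P : Ideal S, P.IsPrime → p.map (algebraMap R S) ≤ P → HasDepth P n (S ⊗[R] M)) :
    HasDepth p n M := by
  induction n generalizing M with
  | zero => exact zero
  | succ n ih =>
    have hsoc : ∀ u : M, (∀ r ∈ p, r • u = 0) → u = 0 := by
      intro u hu
      by_contra hu0
      let g : (R ⧸ p) →ₗ[R] M := p.liftQ (LinearMap.toSpanSingleton R M u) (by
        intro r hr; simpa using hu r hr)
      have hg : Function.Injective g := by
        rw [← LinearMap.ker_eq_bot, Submodule.ker_liftQ_eq_bot']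
        refine le_antisymm (fun r hr => by simpa using hu r hr) (fun r hr => ?_)
        by_contra hrp
        obtain ⟨a, b, hb, hab⟩ := hpm.exists_inv hrp
        apply hu0
        rw [← one_smul R u, ← hab, add_smul, mul_smul]
        have : r • u = 0 := by simpa using hr
        rw [this, smul_zero, hu b hb, add_zero]
      -- `g` identifies `R ⧸ p` with `R u`, so `1 ⊗ u` is nonzero because `p` does not generate `S`
      have hg' := Module.Flat.lTensor_preserves_injective_linearMap (M := S) g hg
      have hne : (1 : S) ⊗ₜ[R] u ≠ 0 := by
        intro h0
        have h1 : (1 : S) ⊗ₜ[R] (Ideal.Quotient.mk p 1) = 0 := by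
          apply hg'
          rw [LinearMap.lTensor_tmul, map_zero, ← h0]
          congr 1
          exact (p.liftQ_apply _ _).trans (by simp)
        have h2 : (1 : S ⧸ p.map (algebraMap R S)) = 0 := by
          apply (Algebra.TensorProduct.quotIdealMapEquivTensorQuot S p).injective
          rw [map_one, map_zero]
          exact h1
        exact hp ((Ideal.eq_top_iff_one _).2 (Ideal.Quotient.eq_zero_iff_mem.1 h2))
      obtain ⟨P, hP, hPle⟩ := exists_le_isAssociatedPrime_of_isNoetherianRing S _ hne
      obtain ⟨hP', w, hw⟩ := isAssociatedPrime_iff.1 hP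
      have hmap : p.map (algebraMap R S) ≤ P := by
        refine Ideal.map_le_iff_le_comap.2 fun r hr => hPle ?_
        rw [Submodule.mem_colon_singleton, Submodule.mem_bot, algebraMap_smul,
          ← TensorProduct.tmul_smul, hu r hr, TensorProduct.tmul_zero]
      have hw0 := (h P hP' hmap).eq_zero_of_smul_eq_zero w fun r hr => by
        rwa [hw, Submodule.mem_colon_singleton, Submodule.mem_bot] at hr
      exact hP'.ne_top (by rw [hw, hw0]; ext; simp)
    obtain ⟨x, hxp, hx⟩ := exists_isSMulRegular_of_forall_eq_zero hsoc
    refine succ_iff.2 ⟨x, hxp, hx, ih fun P hP hle => ?_⟩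
    refine (quotSMulTop (h P hP hle) (hle (Ideal.mem_map_of_mem _ hxp)) ?_).congr
      (QuotSMulTop.algebraMapTensorEquivTensorQuotSMulTop x M S)
    exact hx.of_flat_of_isBaseChange (TensorProduct.isBaseChange R M S)

/-- Depth at a maximal ideal may be tested in the localization. -/
theorem of_localization (p : Ideal R) [hpm : p.IsMaximal]
    (h : HasDepth (IsLocalRing.maximalIdeal (Localization.AtPrime p)) n
      (LocalizedModule p.primeCompl M)) : HasDepth p n M := by
  have : Module.Flat R (Localization.AtPrime p) := IsLocalization.flat _ p.primeCompl
  refine of_flat (Localization.AtPrime p) p ?_ fun P hP hle => ?_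
  · rw [Localization.AtPrime.map_eq_maximalIdeal]
    exact Ideal.IsPrime.ne_top'
  · rw [Localization.AtPrime.map_eq_maximalIdeal] at hle
    obtain rfl := (IsLocalRing.maximalIdeal.isMaximal _).eq_of_le hP.ne_top hle
    exact h.congr (LocalizedModule.equivTensorProduct p.primeCompl M)

end Noetherian

end HasDepth

theorem hasDepth_of_le_localDepth {R M : Type*} [CommRing R] [IsLocalRing R]
    [AddCommGroup M] [Module R M] {n : ℕ} (h : (n : ℕ∞) ≤ localDepth R M) :
    HasDepth (IsLocalRing.maximalIdeal R) n M := by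
  cases n with
  | zero => exact HasDepth.zero
  | succ n =>
    -- the supremum need not be attained if it is infinite, but some sequence is longer than `n`
    have hlt : (n : ℕ∞) < localDepth R M := lt_of_lt_of_le (by exact_mod_cast n.lt_succ_self) h
    simp only [localDepth, lt_iSup_iff] at hlt
    obtain ⟨rs, ⟨hr, hm⟩, hl⟩ := hlt
    exact HasDepth.of_le ⟨rs, rfl, hm, hr.toIsWeaklyRegular⟩ (by exact_mod_cast hl)

/-- A weakly regular sequence in `p` becomes regular in the localization at `p`, by Nakayama. -/
theorem HasDepth.le_localDepth {R M : Type*} [CommRing R] [AddCommGroup M] [Module R M]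
    [Module.Finite R M] {n : ℕ} (p : Ideal R) [p.IsPrime] (h : HasDepth p n M)
    [Nontrivial (LocalizedModule p.primeCompl M)] :
    (n : ℕ∞) ≤ localDepth (Localization.AtPrime p) (LocalizedModule p.primeCompl M) := by
  obtain ⟨rs, hl, hm, hr⟩ := h
  have : Module.Finite (Localization.AtPrime p) (LocalizedModule p.primeCompl M) :=
    Module.Finite.of_isLocalizedModule p.primeCompl (LocalizedModule.mkLinearMap p.primeCompl M)
  have hreg := hr.isRegular_of_isLocalizedModule_of_mem (Localization.AtPrime p) p
    (LocalizedModule.mkLinearMap p.primeCompl M) hm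
  refine le_iSup₂_of_le (rs.map (algebraMap R (Localization.AtPrime p))) ⟨hreg, ?_⟩ (by simp [hl])
  intro r hr
  obtain ⟨a, ha, rfl⟩ := List.mem_map.1 hr
  rw [← Localization.AtPrime.map_eq_maximalIdeal]
  exact Ideal.mem_map_of_mem _ (hm a ha)

/-! ### Regular sequences and polynomial rings -/

section PolynomialIndependence

open Polynomial in
/-- If `x` is regular on `M` and the images of the `e i` in `M/xM` satisfy no linear relation with
coefficients in `S`, then the `e i` satisfy no linear relation with coefficients in `S[X]`,
where `X` acts as `x`: the constant coefficients of a relation vanish, and it can be divided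
by `X`. -/
theorem finsupp_polynomial_eq_zero_of_isSMulRegular {S R M ι : Type*} [CommRing S] [CommRing R]
    [AddCommGroup M] [Module R M] (f : S →+* R) {x : R} (hx : IsSMulRegular M x) (e : ι → M)
    (he : ∀ c : ι →₀ S,
      (c.sum fun i s => f s • (Submodule.Quotient.mk (e i) : QuotSMulTop x M)) = 0 → c = 0)
    (q : ι →₀ S[X]) (hq : (q.sum fun i p => p.eval₂ f x • e i) = 0) : q = 0 := by
  obtain ⟨N, hN⟩ : ∃ N, ∀ i, (q i).natDegree ≤ N := by
    refine ⟨q.support.sup fun i => (q i).natDegree, fun i => ?_⟩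
    by_cases hi : i ∈ q.support
    · exact Finset.le_sup (f := fun i => (q i).natDegree) hi
    · rw [Finsupp.notMem_support_iff.1 hi]; simp
  induction N generalizing q with
  | zero =>
    have hc := he (q.mapRange (fun p => p.coeff 0) (coeff_zero 0)) (by
      rw [Finsupp.sum_mapRange_index (by simp)]
      have := congrArg (Submodule.mkQ (x • (⊤ : Submodule R M))) hq
      rw [map_zero, map_finsuppSum] at this
      rw [← this]
      refine Finsupp.sum_congr fun i _ => ?_
      rw [map_smul, eq_C_of_natDegree_le_zero (hN i)]
      simp)
    ext1 i
    rw [eq_C_of_natDegree_le_zero (hN i)]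
    have := DFunLike.congr_fun hc i
    simp only [Finsupp.mapRange_apply, Finsupp.coe_zero, Pi.zero_apply] at this
    simp [this]
  | succ N ih =>
    have hev : ∀ p : S[X], p.eval₂ f x = x * p.divX.eval₂ f x + f (p.coeff 0) := fun p => by
      conv_lhs => rw [← divX_mul_X_add p]
      rw [eval₂_add, eval₂_mul, eval₂_X, eval₂_C, mul_comm]
    have hc := he (q.mapRange (fun p => p.coeff 0) (coeff_zero 0)) (by
      rw [Finsupp.sum_mapRange_index (by simp)]
      have := congrArg (Submodule.mkQ (x • (⊤ : Submodule R M))) hq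
      rw [map_zero, map_finsuppSum] at this
      rw [← this]
      refine Finsupp.sum_congr fun i _ => ?_
      rw [hev, add_smul, map_add, mul_smul]
      have h0 : (x • (⊤ : Submodule R M)).mkQ (x • (q i).divX.eval₂ f x • e i) = 0 :=
        quotSMulTop_mk_eq_zero_iff.2 ⟨_, rfl⟩
      rw [h0, zero_add, map_smul]
      rfl)
    have hc' : ∀ i, (q i).coeff 0 = 0 := fun i => by
      simpa using DFunLike.congr_fun hc i
    have hd := ih (q.mapRange divX (by simp)) (by
      rw [Finsupp.sum_mapRange_index (by simp)]
      apply hx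
      change x • _ = x • (0 : M)
      rw [smul_zero, ← hq, Finsupp.smul_sum]
      refine Finsupp.sum_congr fun i _ => ?_
      rw [hev (q i), hc', map_zero, add_zero, mul_smul]) (fun i => by
        simp only [Finsupp.mapRange_apply, natDegree_divX_eq_natDegree_tsub_one]
        have := hN i
        omega)
    ext1 i
    have := DFunLike.congr_fun hd i
    simp only [Finsupp.mapRange_apply, Finsupp.coe_zero, Pi.zero_apply] at this
    rw [← divX_mul_X_add (q i), this, hc']
    simp

theorem MvPolynomial.aeval_eq_eval₂_finSuccEquiv {K R : Type*} [CommRing K] [CommRing R]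
    [Algebra K R] {n : ℕ} (θ : Fin (n + 1) → R) (q : MvPolynomial (Fin (n + 1)) K) :
    MvPolynomial.aeval θ q = (MvPolynomial.finSuccEquiv K n q).eval₂
      (MvPolynomial.aeval (fun i => θ i.succ) : MvPolynomial (Fin n) K →ₐ[K] R).toRingHom
      (θ 0) := by
  let g : Polynomial (MvPolynomial (Fin n) K) →+* R := Polynomial.eval₂RingHom
    (MvPolynomial.aeval (fun i => θ i.succ) : MvPolynomial (Fin n) K →ₐ[K] R).toRingHom (θ 0)
  have : (MvPolynomial.aeval θ : MvPolynomial (Fin (n + 1)) K →ₐ[K] R).toRingHom =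
      g.comp (MvPolynomial.finSuccEquiv K n).toRingEquiv.toRingHom := by
    apply MvPolynomial.ringHom_ext
    · intro r
      simp [g, MvPolynomial.finSuccEquiv_apply]
    · intro i
      refine Fin.cases ?_ (fun j => ?_) i
      · simp [g, MvPolynomial.finSuccEquiv_apply]
      · simp [g, MvPolynomial.finSuccEquiv_apply]
  exact DFunLike.congr_fun this q

/-- Elements that are linearly independent over `K` modulo a weakly regular sequence `θ` are
linearly independent over the polynomial ring acting through `θ`. -/
theorem finsupp_mvPolynomial_eq_zero_of_isWeaklyRegular {K R M ι : Type*} [CommRing K] [CommRing R]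
    [Algebra K R] [AddCommGroup M] [Module R M] {n : ℕ} (θ : Fin n → R)
    (hθ : IsWeaklyRegular M (List.ofFn θ)) (e : ι → M)
    (he : ∀ c : ι →₀ K, (c.sum fun i s => algebraMap K R s • e i) ∈
      (Ideal.ofList (List.ofFn θ) • ⊤ : Submodule R M) → c = 0)
    (q : ι →₀ MvPolynomial (Fin n) K)
    (hq : (q.sum fun i p => MvPolynomial.aeval θ p • e i) = 0) : q = 0 := by
  induction n generalizing M with
  | zero =>
    have hc : ∀ p : MvPolynomial (Fin 0) K, p = MvPolynomial.C (MvPolynomial.coeff 0 p) := fun p =>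
      MvPolynomial.eq_C_of_isEmpty p
    have := he (q.mapRange (MvPolynomial.coeff 0) (MvPolynomial.coeff_zero 0)) (by
      rw [Finsupp.sum_mapRange_index (by simp)]
      convert! Submodule.zero_mem _
      rw [← hq]
      refine Finsupp.sum_congr fun i _ => ?_
      conv_rhs => rw [hc (q i), MvPolynomial.aeval_C])
    ext1 i
    have := DFunLike.congr_fun this i
    simp only [Finsupp.mapRange_apply, Finsupp.coe_zero, Pi.zero_apply] at this
    rw [hc (q i), this]
    simp
  | succ n ih =>
    rw [List.ofFn_succ, isWeaklyRegular_cons_iff] at hθ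
    have hinj := (MvPolynomial.finSuccEquiv K n).injective
    have := finsupp_polynomial_eq_zero_of_isSMulRegular
      (MvPolynomial.aeval (fun i => θ i.succ) : MvPolynomial (Fin n) K →ₐ[K] R).toRingHom
      hθ.1 e (fun c hc => ih (fun i => θ i.succ) hθ.2 _ (fun c hc => he c (by
        have h1 : (Submodule.Quotient.mk (c.sum fun i s => algebraMap K R s • e i) :
            QuotSMulTop (θ 0) M) ∈
            (Ideal.ofList (List.ofFn fun i => θ i.succ) • ⊤ : Submodule R M).map
              (Submodule.mkQ _) := by
          rw [Submodule.map_smul'', Submodule.map_top, Submodule.range_mkQ]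
          convert! hc
          exact map_finsuppSum (Submodule.mkQ (θ 0 • (⊤ : Submodule R M))) _ _
        obtain ⟨y, hy, hyc⟩ := h1
        obtain ⟨v, hv⟩ := quotSMulTop_mk_eq_zero_iff.1
          ((Submodule.Quotient.mk_sub _).trans (sub_eq_zero.2 hyc.symm))
        rw [List.ofFn_succ, Ideal.ofList_cons_smul]
        rw [← sub_add_cancel (c.sum fun i s => algebraMap K R s • e i) y, ← hv]
        exact Submodule.add_mem_sup (Submodule.smul_mem_pointwise_smul _ _ _ trivial) hy)) c hc)
      (q.mapRange (MvPolynomial.finSuccEquiv K n) (map_zero _)) (by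
        rw [Finsupp.sum_mapRange_index (by simp), ← hq]
        refine Finsupp.sum_congr fun i _ => ?_
        rw [MvPolynomial.aeval_eq_eval₂_finSuccEquiv])
    ext1 i
    apply hinj
    simpa using DFunLike.congr_fun this i

end PolynomialIndependence

/-- The elements `X i - a i` form a regular sequence in a polynomial ring over a field. Modulo the
first `j` of them every polynomial equals its evaluation at `X i = a i` for `i < j`. -/
theorem MvPolynomial.isWeaklyRegular_X_sub_C {K : Type*} [Field K] {n : ℕ} (a : Fin n → K) :
    IsWeaklyRegular (MvPolynomial (Fin n) K)
      (List.ofFn fun i => (MvPolynomial.X i - MvPolynomial.C (a i) : MvPolynomial (Fin n) K)) := by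
  set L := List.ofFn fun i => (MvPolynomial.X i - MvPolynomial.C (a i) : MvPolynomial (Fin n) K)
    with hL
  rw [isWeaklyRegular_iff_Fin]
  intro i
  have hlen : L.length = n := by simp [L]
  let i' : Fin n := ⟨i, by have := i.2; omega⟩
  have hget : L[i] = X i' - C (a i') := by simp [L, i']
  set I := Ideal.ofList (L.take i)
  let φ : MvPolynomial (Fin n) K →ₐ[K] MvPolynomial (Fin n) K :=
    aeval fun j => if j < i' then C (a j) else X j
  have hmem : ∀ j < i', X j - C (a j) ∈ I := fun j hj => by
    refine Ideal.subset_span (List.mem_take_iff_getElem.2 ⟨j, ?_, by simp [L]⟩)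
    simp only [hlen, lt_min_iff]
    exact ⟨hj, j.2⟩
  have hφ : ∀ f, Ideal.Quotient.mk I (φ f) = Ideal.Quotient.mk I f := by
    intro f
    have : (Ideal.Quotient.mkₐ K I).comp φ = Ideal.Quotient.mkₐ K I := by
      ext j
      by_cases hj : j < i'
      · have := Ideal.Quotient.eq.2 (hmem j hj)
        simpa [φ, hj] using this.symm
      · simp [φ, hj]
    exact DFunLike.congr_fun this f
  have hker : I ≤ RingHom.ker φ := by
    refine Ideal.span_le.2 fun x hx => ?_
    obtain ⟨j, hj, rfl⟩ := List.mem_take_iff_getElem.1 hx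
    simp only [hlen, lt_min_iff] at hj
    have hj' : (⟨j, hj.2⟩ : Fin n) < i' := hj.1
    simp [L, φ, hj']
  rw [isSMulRegular_quotient_iff_mem_of_smul_mem]
  intro f hf
  rw [smul_eq_mul, Ideal.mul_top] at hf ⊢
  rw [hget, smul_eq_mul] at hf
  have h1 : φ (X i' - C (a i')) * φ f = 0 := by rw [← map_mul]; exact hker hf
  have h2 : φ (X i' - C (a i')) = X i' - C (a i') := by simp [φ]
  have h3 : (X i' - C (a i') : MvPolynomial (Fin n) K) ≠ 0 := by
    intro h0
    have := congrArg (MvPolynomial.eval fun _ => a i' + 1) h0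
    simp at this
  rw [h2, mul_eq_zero, or_iff_right h3] at h1
  rw [← Ideal.Quotient.eq_zero_iff_mem, ← hφ, h1, map_zero]

/-! ### Connected graded algebras -/

namespace GradedAlgebra

section Projections

variable {K R : Type*} [Field K] [CommRing R] [Algebra K R] (ℛ : ℕ → Submodule K R)
  [GradedAlgebra ℛ]

theorem proj_mem (n : ℕ) (r : R) : proj ℛ n r ∈ ℛ n := SetLike.coe_mem _

theorem proj_of_mem {n : ℕ} {r : R} (h : r ∈ ℛ n) : proj ℛ n r = r :=
  DirectSum.decompose_of_mem_same ℛ h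

theorem proj_of_mem_of_ne {n m : ℕ} {r : R} (h : r ∈ ℛ n) (hnm : n ≠ m) : proj ℛ m r = 0 :=
  DirectSum.decompose_of_mem_ne ℛ h hnm

theorem proj_mul_of_mem {i n : ℕ} {a : R} (ha : a ∈ ℛ i) (h : i ≤ n) (b : R) :
    proj ℛ n (a * b) = a * proj ℛ (n - i) b :=
  DirectSum.coe_decompose_mul_of_left_mem_of_le ℛ ha h

theorem proj_mul_of_mem_of_lt {i n : ℕ} {a : R} (ha : a ∈ ℛ i) (h : n < i) (b : R) :
    proj ℛ n (a * b) = 0 :=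
  DirectSum.coe_decompose_mul_of_left_mem_of_not_le ℛ ha (not_le.2 h)

theorem mem_of_forall_proj_mem {S : Type*} [SetLike S R] [AddSubmonoidClass S R] (N : S) {r : R}
    (h : ∀ n, proj ℛ n r ∈ N) : r ∈ N := by
  classical
  rw [← DirectSum.sum_support_decompose ℛ r]
  exact sum_mem fun i _ => h i

/-- The sum of the graded pieces of degree less than `n`. -/
def lowDegree (n : ℕ) : Submodule K R := ⨅ i ≥ n, LinearMap.ker (proj ℛ i)

variable {ℛ}

theorem mem_lowDegree {n : ℕ} {r : R} : r ∈ lowDegree ℛ n ↔ ∀ i ≥ n, proj ℛ i r = 0 := by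
  simp [lowDegree, Submodule.mem_iInf]

theorem mem_lowDegree_of_mem {i n : ℕ} {r : R} (h : r ∈ ℛ i) (hin : i < n) :
    r ∈ lowDegree ℛ n :=
  mem_lowDegree.2 fun j hj => proj_of_mem_of_ne ℛ h (by omega)

theorem lowDegree_mono {n m : ℕ} (h : n ≤ m) : lowDegree ℛ n ≤ lowDegree ℛ m := fun _ hr =>
  mem_lowDegree.2 fun j hj => mem_lowDegree.1 hr j (h.trans hj)

theorem mul_mem_lowDegree {i n : ℕ} {a b : R} (ha : a ∈ ℛ i) (hb : b ∈ lowDegree ℛ n) :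
    a * b ∈ lowDegree ℛ (i + n) := mem_lowDegree.2 fun j hj => by
  rw [proj_mul_of_mem ℛ ha (by omega), mem_lowDegree.1 hb _ (by omega), mul_zero]

theorem eq_sum_proj_of_mem_lowDegree {n : ℕ} {r : R} (h : r ∈ lowDegree ℛ n) :
    r = ∑ i ∈ Finset.range n, proj ℛ i r := by
  classical
  conv_lhs => rw [← DirectSum.sum_support_decompose ℛ r]
  refine Finset.sum_subset (fun i hi => ?_) (fun i _ hi => ?_)
  · rw [Finset.mem_range]
    by_contra hin
    rw [DFinsupp.mem_support_iff] at hi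
    exact hi (Subtype.ext (mem_lowDegree.1 h i (not_lt.1 hin)))
  · rw [DFinsupp.notMem_support_iff] at hi
    rw [hi]; rfl

variable (ℛ) in
/-- The part of degree less than `n` is the product of the first `n` graded pieces. -/
noncomputable def lowDegreeEquiv (n : ℕ) : lowDegree ℛ n ≃ₗ[K] (Π i : Fin n, ℛ i) where
  toFun r i := ⟨proj ℛ i r, proj_mem ℛ i _⟩
  map_add' r s := by ext; simp
  map_smul' c r := by ext; simp
  invFun f := ⟨∑ i, (f i : R), Submodule.sum_mem _ fun i _ => mem_lowDegree_of_mem (f i).2 i.2⟩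
  left_inv r := by
    ext
    conv_rhs => rw [eq_sum_proj_of_mem_lowDegree r.2, Finset.sum_range]
  right_inv f := by
    ext i
    simp only [map_sum]
    rw [Finset.sum_eq_single i]
    · exact proj_of_mem ℛ (f i).2
    · intro j _ hj
      exact proj_of_mem_of_ne ℛ (f j).2 (fun h => hj (Fin.ext h))
    · simp

theorem finite_lowDegree [∀ i, Module.Finite K (ℛ i)] (n : ℕ) :
    Module.Finite K (lowDegree ℛ n) :=
  Module.Finite.equiv (lowDegreeEquiv ℛ n).symm

theorem finrank_lowDegree [∀ i, Module.Finite K (ℛ i)] (n : ℕ) :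
    Module.finrank K (lowDegree ℛ n) = ∑ i ∈ Finset.range n, Module.finrank K (ℛ i) := by
  rw [(lowDegreeEquiv ℛ n).finrank_eq, Module.finrank_pi_fintype, Finset.sum_range]

end Projections

section Connected

variable {K R : Type*} [Field K] [CommRing R] [Algebra K R] {ℛ : ℕ → Submodule K R}
  [GradedAlgebra ℛ]

theorem exists_algebraMap_eq (h0 : IsPositivelyGraded ℛ) {r : R} (hr : r ∈ ℛ 0) :
    ∃ c : K, algebraMap K R c = r := by
  obtain ⟨c, hc⟩ := h0.2 ⟨r, hr⟩
  exact ⟨c, congrArg Subtype.val hc⟩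

theorem exists_proj_zero_eq (h0 : IsPositivelyGraded ℛ) (r : R) :
    ∃ c : K, proj ℛ 0 r = algebraMap K R c := by
  obtain ⟨c, hc⟩ := exists_algebraMap_eq h0 (proj_mem ℛ 0 r)
  exact ⟨c, hc.symm⟩

theorem nontrivial_of_isPositivelyGraded (h0 : IsPositivelyGraded ℛ) : Nontrivial R := by
  refine ⟨⟨0, 1, fun h => ?_⟩⟩
  have : algebraMap K (ℛ 0) 0 = algebraMap K (ℛ 0) 1 := by
    rw [map_zero, map_one]; exact Subtype.ext h
  exact zero_ne_one (h0.1 this)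

theorem finrank_zero (h0 : IsPositivelyGraded ℛ) : Module.finrank K (ℛ 0) = 1 := by
  rw [← (LinearEquiv.ofBijective (Algebra.linearMap K (ℛ 0)) h0).finrank_eq]
  exact Module.finrank_self K

theorem mem_irrelevant {r : R} :
    r ∈ (HomogeneousIdeal.irrelevant ℛ).toIdeal ↔ proj ℛ 0 r = 0 := Iff.rfl

theorem irrelevant_isMaximal (h0 : IsPositivelyGraded ℛ) :
    (HomogeneousIdeal.irrelevant ℛ).toIdeal.IsMaximal := by
  have := nontrivial_of_isPositivelyGraded h0
  rw [Ideal.isMaximal_iff]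
  refine ⟨fun h => ?_, fun J x hJ hx hxJ => ?_⟩
  · rw [mem_irrelevant, proj_of_mem ℛ SetLike.GradedOne.one_mem] at h
    exact one_ne_zero h
  · obtain ⟨c, hc⟩ := exists_proj_zero_eq h0 x
    have hc0 : c ≠ 0 := by
      rintro rfl
      exact hx (mem_irrelevant.2 (by rw [hc, map_zero]))
    have h1 : x - algebraMap K R c ∈ J := hJ (mem_irrelevant.2 (by
      rw [map_sub, hc, proj_of_mem ℛ (SetLike.algebraMap_mem_graded ℛ c), sub_self]))
    have h2 : algebraMap K R c ∈ J := by
      have := J.sub_mem hxJ h1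
      rwa [sub_sub_cancel] at this
    have := J.mul_mem_left (algebraMap K R c⁻¹) h2
    rwa [← map_mul, inv_mul_cancel₀ hc0, map_one] at this

theorem finite_piece [IsNoetherianRing R] (h0 : IsPositivelyGraded ℛ) (n : ℕ) :
    Module.Finite K (ℛ n) := by
  obtain ⟨s, hs, hspan⟩ := (Submodule.fg_span_iff_fg_span_finset_subset (R := R)
    (ℛ n : Set R)).1 (IsNoetherian.noetherian _)
  have hle : ℛ n = Submodule.span K (s : Set R) := by
    apply le_antisymm
    · intro r hr
      have : r ∈ Submodule.span R (s : Set R) := hspan ▸ Submodule.subset_span hr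
      obtain ⟨f, hf, rfl⟩ := Submodule.mem_span_finset.1 this
      rw [← proj_of_mem ℛ hr, map_sum]
      refine Submodule.sum_mem _ fun a ha => ?_
      rw [smul_eq_mul, mul_comm, proj_mul_of_mem ℛ (hs ha) le_rfl, Nat.sub_self]
      obtain ⟨c, hc⟩ := exists_proj_zero_eq h0 (f a)
      rw [hc, mul_comm, ← Algebra.smul_def]
      exact Submodule.smul_mem _ _ (Submodule.subset_span ha)
    · exact Submodule.span_le.2 hs
  rw [Module.Finite.iff_fg, hle]
  exact Submodule.fg_span s.finite_toSet

/-- A Noetherian positively graded algebra is generated by homogeneous generators of its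
irrelevant ideal. -/
theorem finiteType [IsNoetherianRing R] (h0 : IsPositivelyGraded ℛ) : Algebra.FiniteType K R := by
  obtain ⟨s, hs, hspan⟩ := (Submodule.fg_span_iff_fg_span_finset_subset (R := R)
    (⋃ i > 0, ℛ i : Set R)).1 (IsNoetherian.noetherian _)
  refine ⟨s, ?_⟩
  rw [eq_top_iff]
  have key : ∀ n, ∀ r ∈ ℛ n, r ∈ Algebra.adjoin K (s : Set R) := by
    intro n
    induction n using Nat.strong_induction_on with
    | _ n ih =>
      intro r hr
      rcases Nat.eq_zero_or_pos n with rfl | hn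
      · obtain ⟨c, rfl⟩ := exists_algebraMap_eq h0 hr
        exact Subalgebra.algebraMap_mem _ c
      · have hmem : r ∈ Submodule.span R (s : Set R) :=
          hspan ▸ Submodule.subset_span (Set.mem_biUnion (x := n) hn hr)
        obtain ⟨f, hf, rfl⟩ := Submodule.mem_span_finset.1 hmem
        rw [← proj_of_mem ℛ hr, map_sum]
        refine Subalgebra.sum_mem _ fun a ha => ?_
        obtain ⟨i, hi, hai⟩ := Set.mem_iUnion₂.1 (hs ha)
        rw [smul_eq_mul, mul_comm]
        by_cases hin : i ≤ n
        · rw [proj_mul_of_mem ℛ hai hin]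
          exact Subalgebra.mul_mem _ (Algebra.subset_adjoin ha)
            (ih (n - i) (by have : 0 < i := hi; omega) _ (proj_mem ℛ _ _))
        · rw [proj_mul_of_mem_of_lt ℛ hai (by omega)]
          exact Subalgebra.zero_mem _
  intro r _
  exact mem_of_forall_proj_mem ℛ _ fun n => key n _ (proj_mem ℛ n r)

/-- A form of the graded Nakayama lemma: if `R = W + θR` for a homogeneous subspace `W` and linear
forms `θ`, then a subspace containing `W` and stable under the `θ i` is everything. -/
theorem eq_top_of_stable {d : ℕ} {θ : Fin d → R} (hθ : ∀ i, θ i ∈ ℛ 1) {W N : Submodule K R}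
    (hW : ∀ w ∈ W, ∀ n, proj ℛ n w ∈ W)
    (hWθ : ∀ r, ∃ w ∈ W, r - w ∈ Ideal.span (Set.range θ)) (hWN : W ≤ N)
    (hN : ∀ i, ∀ x ∈ N, θ i * x ∈ N) : N = ⊤ := by
  have key : ∀ n, ∀ r ∈ ℛ n, r ∈ N := by
    intro n
    induction n using Nat.strong_induction_on with
    | _ n ih =>
      intro r hr
      obtain ⟨w, hw, hrw⟩ := hWθ r
      obtain ⟨c, hc⟩ := Ideal.mem_span_range_iff_exists_fun.1 hrw
      rw [← proj_of_mem ℛ hr, ← sub_add_cancel r w, ← hc, map_add, map_sum]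
      refine N.add_mem (N.sum_mem fun i _ => ?_) (hWN (hW w hw n))
      rw [mul_comm]
      rcases Nat.eq_zero_or_pos n with rfl | hn
      · rw [proj_mul_of_mem_of_lt ℛ (hθ i) (by omega)]
        exact N.zero_mem
      · rw [proj_mul_of_mem ℛ (hθ i) hn]
        exact hN i _ (ih (n - 1) (by omega) _ (proj_mem ℛ _ _))
  exact eq_top_iff.2 fun r _ => mem_of_forall_proj_mem ℛ _ fun n => key n _ (proj_mem ℛ n r)

end Connected

section Standard

variable {K R : Type*} [Field K] [CommRing R] [Algebra K R] {ℛ : ℕ → Submodule K R}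
  [GradedAlgebra ℛ]

theorem irrelevant_eq_span_one (hstd : IsStandardGraded ℛ) :
    (HomogeneousIdeal.irrelevant ℛ).toIdeal = Ideal.span (ℛ 1 : Set R) := by
  have := nontrivial_of_isPositivelyGraded hstd.1
  apply le_antisymm
  · have key : ∀ r : R, ∃ c : K, r - algebraMap K R c ∈ Ideal.span (ℛ 1 : Set R) := by
      intro r
      have hr : r ∈ Algebra.adjoin K (ℛ 1 : Set R) := hstd.2 ▸ Algebra.mem_top
      induction hr using Algebra.adjoin_induction with
      | mem x hx => exact ⟨0, by simpa using Ideal.subset_span hx⟩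
      | algebraMap c => exact ⟨c, by simp⟩
      | add x y _ _ hx hy =>
        obtain ⟨c, hc⟩ := hx
        obtain ⟨c', hc'⟩ := hy
        exact ⟨c + c', by rw [map_add, add_sub_add_comm]; exact Ideal.add_mem _ hc hc'⟩
      | mul x y _ _ hx hy =>
        obtain ⟨c, hc⟩ := hx
        obtain ⟨c', hc'⟩ := hy
        refine ⟨c * c', ?_⟩
        have : x * y - algebraMap K R (c * c') =
            (x - algebraMap K R c) * y + algebraMap K R c * (y - algebraMap K R c') := by
          rw [map_mul]; ring
        rw [this]
        exact Ideal.add_mem _ (Ideal.mul_mem_right _ _ hc) (Ideal.mul_mem_left _ _ hc')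
    have hle : Ideal.span (ℛ 1 : Set R) ≤ (HomogeneousIdeal.irrelevant ℛ).toIdeal :=
      Ideal.span_le.2 fun x hx => mem_irrelevant.2 (proj_of_mem_of_ne ℛ hx (by omega))
    intro r hr
    obtain ⟨c, hc⟩ := key r
    have h2 : algebraMap K R c = 0 := by
      have := mem_irrelevant.1 (Ideal.sub_mem _ hr (hle hc))
      rwa [sub_sub_cancel, proj_of_mem ℛ (SetLike.algebraMap_mem_graded ℛ c)] at this
    rwa [h2, sub_zero] at hc
  · exact Ideal.span_le.2 fun x hx => mem_irrelevant.2 (proj_of_mem_of_ne ℛ hx (by omega))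

theorem mem_irrelevant_pow (hstd : IsStandardGraded ℛ) {n : ℕ} {r : R} (hr : r ∈ ℛ n) :
    r ∈ (HomogeneousIdeal.irrelevant ℛ).toIdeal ^ n := by
  induction n generalizing r with
  | zero => simp
  | succ n ih =>
    have hmem : r ∈ Submodule.span R (ℛ 1 : Set R) := by
      have : r ∈ (HomogeneousIdeal.irrelevant ℛ).toIdeal :=
        mem_irrelevant.2 (proj_of_mem_of_ne ℛ hr (by omega))
      rwa [irrelevant_eq_span_one hstd] at this
    obtain ⟨m, f, g, rfl⟩ := Submodule.mem_span_set'.1 hmem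
    rw [← proj_of_mem ℛ hr, map_sum]
    refine Ideal.sum_mem _ fun i _ => ?_
    rw [smul_eq_mul, mul_comm, proj_mul_of_mem ℛ (g i).2 (by omega), mul_comm, pow_succ]
    refine Ideal.mul_mem_mul (ih (proj_mem ℛ n (f i))) ?_
    exact mem_irrelevant.2 (proj_of_mem_of_ne ℛ (g i).2 (by omega))

theorem mem_irrelevant_pow_of_proj (hstd : IsStandardGraded ℛ) {n : ℕ} {r : R}
    (hr : ∀ i < n, proj ℛ i r = 0) : r ∈ (HomogeneousIdeal.irrelevant ℛ).toIdeal ^ n := by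
  refine mem_of_forall_proj_mem ℛ _ fun i => ?_
  rcases lt_or_ge i n with hi | hi
  · rw [hr i hi]; exact Ideal.zero_mem _
  · exact Ideal.pow_le_pow_right hi (mem_irrelevant_pow hstd (proj_mem ℛ i r))

theorem proj_eq_zero_of_mem_pow {n i : ℕ} (hi : i < n) {r : R}
    (hr : r ∈ (HomogeneousIdeal.irrelevant ℛ).toIdeal ^ n) : proj ℛ i r = 0 := by
  induction n generalizing i r with
  | zero => omega
  | succ n ih =>
    rw [pow_succ] at hr
    induction hr using Submodule.mul_induction_on' with
    | mem_mul_mem a ha b hb =>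
      classical
      rw [← DirectSum.sum_support_decompose ℛ b, Finset.mul_sum, map_sum]
      refine Finset.sum_eq_zero fun j _ => ?_
      rw [mul_comm]
      rcases lt_or_ge i j with hij | hij
      · exact proj_mul_of_mem_of_lt ℛ (SetLike.coe_mem _) hij _
      · rw [proj_mul_of_mem ℛ (SetLike.coe_mem _) hij]
        rcases Nat.eq_zero_or_pos j with rfl | hj
        · have : (DirectSum.decompose ℛ b 0 : R) = 0 := mem_irrelevant.1 hb
          rw [this, zero_mul]
        · rw [ih (by omega) ha, mul_zero]
    | add a _ b _ ha hb => rw [map_add, ha, hb, add_zero]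

/-- The part of degree less than `n` injects into `R/𝔪ⁿ`. -/
theorem sum_finrank_le_finrank_quotient (hstd : IsStandardGraded ℛ) [IsNoetherianRing R] (n : ℕ) :
    ∑ i ∈ Finset.range n, Module.finrank K (ℛ i) ≤
      Module.finrank K (R ⧸ (HomogeneousIdeal.irrelevant ℛ).toIdeal ^ n) := by
  have := fun i => finite_piece hstd.1 i
  have hfin := finite_lowDegree (ℛ := ℛ) n
  rw [← finrank_lowDegree]
  let g : lowDegree ℛ n →ₗ[K] (R ⧸ (HomogeneousIdeal.irrelevant ℛ).toIdeal ^ n) :=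
    (Ideal.Quotient.mkₐ K _).toLinearMap ∘ₗ (lowDegree ℛ n).subtype
  have hsurj : Function.Surjective g := by
    intro r
    obtain ⟨r, rfl⟩ := Ideal.Quotient.mk_surjective r
    refine ⟨⟨∑ i ∈ Finset.range n, proj ℛ i r, Submodule.sum_mem _ fun i hi =>
      mem_lowDegree_of_mem (proj_mem ℛ i r) (Finset.mem_range.1 hi)⟩, ?_⟩
    refine Ideal.Quotient.eq.2 (mem_irrelevant_pow_of_proj hstd fun i hi => ?_)
    change proj ℛ i ((∑ j ∈ Finset.range n, proj ℛ j r) - r) = 0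
    rw [map_sub, map_sum, Finset.sum_eq_single i, proj_of_mem ℛ (proj_mem ℛ i r), sub_self]
    · exact fun j _ hj => proj_of_mem_of_ne ℛ (proj_mem ℛ j r) hj
    · exact fun h => absurd (Finset.mem_range.2 hi) h
  have := Module.Finite.of_surjective g hsurj
  refine LinearMap.finrank_le_finrank_of_injective (f := g) ?_
  rw [← LinearMap.ker_eq_bot, eq_bot_iff]
  intro r hr
  have hr' : (r : R) ∈ (HomogeneousIdeal.irrelevant ℛ).toIdeal ^ n :=
    Ideal.Quotient.eq_zero_iff_mem.1 hr
  refine Subtype.ext ?_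
  rw [eq_sum_proj_of_mem_lowDegree r.2]
  exact Finset.sum_eq_zero fun i hi => proj_eq_zero_of_mem_pow (Finset.mem_range.1 hi) hr'

theorem gradedEmbDim_le (hstd : IsStandardGraded ℛ) [IsNoetherianRing R] :
    gradedEmbDim ℛ ≤ Module.finrank K (ℛ 1) := by
  have := finite_piece hstd.1 1
  let g : ℛ 1 →ₗ[K] (HomogeneousIdeal.irrelevant ℛ).toIdeal.Cotangent :=
    { toFun := fun r => (HomogeneousIdeal.irrelevant ℛ).toIdeal.toCotangent
        ⟨r, mem_irrelevant.2 (proj_of_mem_of_ne ℛ r.2 (by omega))⟩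
      map_add' := fun r s => by rw [← map_add]; rfl
      map_smul' := fun c r =>
        ((HomogeneousIdeal.irrelevant ℛ).toIdeal.toCotangent.restrictScalars K).map_smul c
          ⟨r, mem_irrelevant.2 (proj_of_mem_of_ne ℛ r.2 (by omega))⟩ }
  refine LinearMap.finrank_le_finrank_of_surjective (f := g) ?_
  intro x
  obtain ⟨⟨r, hr⟩, rfl⟩ := Ideal.toCotangent_surjective _ x
  refine ⟨⟨proj ℛ 1 r, proj_mem ℛ 1 r⟩, ?_⟩
  refine (Ideal.toCotangent_eq _).2 (mem_irrelevant_pow_of_proj hstd fun i hi => ?_)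
  change proj ℛ i (proj ℛ 1 r - r) = 0
  rw [map_sub]
  obtain rfl | rfl : i = 0 ∨ i = 1 := by omega
  · rw [mem_irrelevant.1 hr, proj_of_mem_of_ne ℛ (proj_mem ℛ 1 r) (by omega), sub_zero]
  · rw [proj_of_mem ℛ (proj_mem ℛ 1 r), sub_self]

end Standard

end GradedAlgebra

/-! ### Hilbert functions and multiplicity -/

theorem Ideal.ofList_ofFn {R : Type*} [CommRing R] {d : ℕ} (θ : Fin d → R) :
    Ideal.ofList (List.ofFn θ) = Ideal.span (Set.range θ) := by
  simp [Ideal.ofList, List.mem_ofFn', Set.range]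

/-- Elements linearly independent over `K` modulo a regular sequence `θ` are linearly independent
over `K[X₁, …, X_d]` acting through `θ`. -/
theorem linearIndependent_mvPolynomial_of_mod {K R ι : Type*} [Field K] [CommRing R] [Algebra K R]
    {d : ℕ} {θ : Fin d → R} [Algebra (MvPolynomial (Fin d) K) R]
    (halg : ∀ p, algebraMap (MvPolynomial (Fin d) K) R p = MvPolynomial.aeval θ p)
    (hθ : IsWeaklyRegular R (List.ofFn θ)) {e : ι → R}
    (he : LinearIndependent K fun i => Ideal.Quotient.mk (Ideal.span (Set.range θ)) (e i)) :
    LinearIndependent (MvPolynomial (Fin d) K) e := by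
  rw [linearIndependent_iff]
  intro q hq
  refine finsupp_mvPolynomial_eq_zero_of_isWeaklyRegular θ hθ e (fun c hc => ?_) q ?_
  · refine linearIndependent_iff.1 he c ?_
    rw [Ideal.ofList_ofFn, smul_eq_mul, Ideal.mul_top, ← Ideal.Quotient.eq_zero_iff_mem] at hc
    rw [← hc, Finsupp.linearCombination_apply, map_finsuppSum]
    refine Finsupp.sum_congr fun i _ => ?_
    rw [smul_eq_mul, ← Algebra.smul_def]
    rfl
  · rw [← hq, Finsupp.linearCombination_apply]
    refine Finsupp.sum_congr fun i _ => ?_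
    rw [smul_eq_mul, Algebra.smul_def, halg]

/-- A finite set of monomials in `d` variables of degree at most `n`, of cardinality
`(n + d).choose d`: they arise from the monomials of degree `n` in `d + 1` variables by
dehomogenization. -/
theorem exists_finset_degree_le (d n : ℕ) :
    ∃ T : Finset (Fin d →₀ ℕ), T.card = (n + d).choose d ∧ ∀ g ∈ T, ∑ i, g i ≤ n := by
  classical
  refine ⟨(Finset.finsuppAntidiag (Finset.univ : Finset (Fin (d + 1))) n).image Finsupp.tail,
    ?_, ?_⟩
  · rw [Finset.card_image_of_injOn, Finset.card_finsuppAntidiag_nat_eq_choose]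
    · rw [Finset.card_univ, Fintype.card_fin, show d + 1 + n - 1 = n + d by omega,
        ← Nat.choose_symm_add]
    · intro g hg h hh hgh
      have hg' := (Finset.mem_finsuppAntidiag.1 hg).1
      have hh' := (Finset.mem_finsuppAntidiag.1 hh).1
      rw [Fin.sum_univ_succ] at hg' hh'
      have htail : ∀ i : Fin d, g i.succ = h i.succ := fun i => DFunLike.congr_fun hgh i
      have h0 : g 0 = h 0 := by
        simp only [htail] at hg'
        omega
      ext i
      exact Fin.cases h0 htail i
  · intro g hg
    obtain ⟨h, hh, rfl⟩ := Finset.mem_image.1 hg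
    have hh' := (Finset.mem_finsuppAntidiag.1 hh).1
    rw [Fin.sum_univ_succ] at hh'
    change ∑ i : Fin d, h i.succ ≤ n
    omega

/-- A quantity growing at least like `N` times the Hilbert function of a polynomial ring in `d`
variables has normalized leading coefficient at least `N`. -/
theorem natCast_le_of_tendsto {d N m : ℕ} {f : ℕ → ℕ} {E : ℝ}
    (hf : ∀ n, N * (n + d).choose d ≤ f (n + m))
    (hE : Tendsto (fun n : ℕ => (d.factorial : ℝ) * (f n : ℝ) / (n : ℝ) ^ d) atTop (𝓝 E)) :
    (N : ℝ) ≤ E := by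
  have h1 := hE.comp (tendsto_add_atTop_nat m)
  have h2 : Tendsto (fun n : ℕ => (N : ℝ) * ((n : ℝ) / ((n : ℝ) + m)) ^ d) atTop
      (𝓝 ((N : ℝ) * 1 ^ d)) :=
    ((tendsto_natCast_div_add_atTop (m : ℝ)).pow d).const_mul _
  rw [one_pow, mul_one] at h2
  refine le_of_tendsto_of_tendsto h2 h1 ?_
  filter_upwards with n
  simp only [Function.comp]
  rw [div_pow, ← mul_div_assoc]
  push_cast
  refine div_le_div_of_nonneg_right ?_ (by positivity)
  have h3 : n ^ d ≤ d.factorial * (n + d).choose d := by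
    rw [← Nat.descFactorial_eq_factorial_mul_choose]
    refine le_trans ?_ (Nat.pow_sub_le_descFactorial (n + d) d)
    exact Nat.pow_le_pow_left (by omega) d
  have h4 : N * n ^ d ≤ d.factorial * f (n + m) := by
    calc N * n ^ d ≤ N * (d.factorial * (n + d).choose d) := Nat.mul_le_mul_left _ h3
      _ = d.factorial * (N * (n + d).choose d) := by ring
      _ ≤ _ := Nat.mul_le_mul_left _ (hf n)
  exact_mod_cast h4

namespace GradedAlgebra

section LinearForms

variable {K R : Type*} [Field K] [CommRing R] [Algebra K R] {ℛ : ℕ → Submodule K R}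
  [GradedAlgebra ℛ] {d : ℕ} {θ : Fin d → R}

theorem proj_mem_span_linear (hθ : ∀ i, θ i ∈ ℛ 1) {r : R} (hr : r ∈ Ideal.span (Set.range θ))
    (n : ℕ) : proj ℛ n r ∈ Ideal.span (Set.range θ) := by
  obtain ⟨c, rfl⟩ := Ideal.mem_span_range_iff_exists_fun.1 hr
  rw [map_sum]
  refine Ideal.sum_mem _ fun i _ => ?_
  rw [mul_comm]
  rcases Nat.eq_zero_or_pos n with rfl | hn
  · rw [proj_mul_of_mem_of_lt ℛ (hθ i) (by omega)]
    exact Ideal.zero_mem _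
  · rw [proj_mul_of_mem ℛ (hθ i) hn]
    exact Ideal.mul_mem_right _ _ (Ideal.subset_span ⟨i, rfl⟩)

/-- The part of degree at most one of the ideal generated by linear forms is their linear span,
because the degree zero part of the ring is the base field. -/
theorem mem_span_of_mem_lowDegree_two (h0 : IsPositivelyGraded ℛ) (hθ : ∀ i, θ i ∈ ℛ 1) {r : R}
    (hr : r ∈ Ideal.span (Set.range θ)) (hr2 : r ∈ lowDegree ℛ 2) :
    r ∈ Submodule.span K (Set.range θ) := by
  rw [eq_sum_proj_of_mem_lowDegree hr2, Finset.sum_range_succ, Finset.sum_range_one]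
  obtain ⟨c, rfl⟩ := Ideal.mem_span_range_iff_exists_fun.1 hr
  rw [map_sum, map_sum, Finset.sum_eq_zero, zero_add]
  · refine Submodule.sum_mem _ fun i _ => ?_
    rw [mul_comm, proj_mul_of_mem ℛ (hθ i) le_rfl, Nat.sub_self]
    obtain ⟨a, ha⟩ := exists_proj_zero_eq h0 (c i)
    rw [ha, mul_comm, ← Algebra.smul_def]
    exact Submodule.smul_mem _ _ (Submodule.subset_span ⟨i, rfl⟩)
  · intro i _
    rw [mul_comm, proj_mul_of_mem_of_lt ℛ (hθ i) (by omega)]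

theorem aeval_monomial_mem (hθ : ∀ i, θ i ∈ ℛ 1) (g : Fin d →₀ ℕ) :
    MvPolynomial.aeval θ (MvPolynomial.monomial g (1 : K)) ∈ ℛ (∑ i, g i) := by
  rw [MvPolynomial.aeval_monomial, map_one, one_mul, Finsupp.prod_fintype _ _ (by simp)]
  refine SetLike.prod_mem_graded ℛ (fun i => g i) _ fun i _ => ?_
  simpa using SetLike.pow_mem_graded (g i) (hθ i)

/-- Each element independent modulo a regular sequence `θ` of `d` linear forms contributes a copy
of the polynomial ring in `d` variables to the Hilbert function. -/
theorem mul_choose_le_finrank_lowDegree [∀ i, Module.Finite K (ℛ i)]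
    (hθ : ∀ i, θ i ∈ ℛ 1) (hreg : IsWeaklyRegular R (List.ofFn θ)) {N m : ℕ} {e : Fin N → R}
    (hem : ∀ j, e j ∈ lowDegree ℛ m)
    (he : LinearIndependent K fun i => Ideal.Quotient.mk (Ideal.span (Set.range θ)) (e i)) (n : ℕ) :
    N * (n + d).choose d ≤ Module.finrank K (lowDegree ℛ (n + m)) := by
  let _ : Algebra (MvPolynomial (Fin d) K) R :=
    (MvPolynomial.aeval θ : MvPolynomial (Fin d) K →ₐ[K] R).toAlgebra
  have : IsScalarTower K (MvPolynomial (Fin d) K) R := .of_algebraMap_eq' (AlgHom.comp_algebraMap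
    (MvPolynomial.aeval θ : MvPolynomial (Fin d) K →ₐ[K] R)).symm
  have hind := linearIndependent_mvPolynomial_of_mod (θ := θ) (fun _ => rfl) hreg he
  obtain ⟨T, hT, hTn⟩ := exists_finset_degree_le d n
  have hmon : LinearIndependent K fun g : T => MvPolynomial.monomial (g : Fin d →₀ ℕ) (1 : K) := by
    have := (MvPolynomial.basisMonomials (Fin d) K).linearIndependent.comp
      (fun g : T => (g : Fin d →₀ ℕ)) Subtype.val_injective
    simpa [Function.comp_def] using! this
  have hprod := linearIndependent_smul hmon hind
  have hmem : ∀ p : T × Fin N,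
      MvPolynomial.monomial (p.1 : Fin d →₀ ℕ) (1 : K) • e p.2 ∈ lowDegree ℛ (n + m) := by
    intro p
    rw [Algebra.smul_def]
    exact lowDegree_mono (Nat.add_le_add_right (hTn _ p.1.2) m)
      (mul_mem_lowDegree (aeval_monomial_mem hθ _) (hem p.2))
  have hfin := finite_lowDegree (ℛ := ℛ) (n + m)
  have := (LinearIndependent.of_comp (v := fun p => (⟨_, hmem p⟩ : lowDegree ℛ (n + m)))
    (lowDegree ℛ (n + m)).subtype hprod).fintype_card_le_finrank
  rwa [Fintype.card_prod, Fintype.card_coe, Fintype.card_fin, hT, mul_comm] at this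

/-- If the multiplicity of `R` is less than `dim R₁ - d + 2`, then `R/θR` vanishes in degrees at
least two for every regular sequence `θ` of `d` linear forms: its length would otherwise exceed
the multiplicity. -/
theorem mem_span_linear_of_two_le [IsNoetherianRing R] (h0 : IsPositivelyGraded ℛ)
    (hθ : ∀ i, θ i ∈ ℛ 1) (hreg : IsWeaklyRegular R (List.ofFn θ)) {f : ℕ → ℕ} {E : ℝ}
    (hf : ∀ n, ∑ i ∈ Finset.range n, Module.finrank K (ℛ i) ≤ f n)
    (hE : Tendsto (fun n : ℕ => (d.factorial : ℝ) * (f n : ℝ) / (n : ℝ) ^ d) atTop (𝓝 E))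
    (hlt : E + d < Module.finrank K (ℛ 1) + 2) {t : ℕ} (ht : 2 ≤ t) {a : R} (ha : a ∈ ℛ t) :
    a ∈ Ideal.span (Set.range θ) := by
  by_contra hcon
  have := fun i => finite_piece h0 i
  have hfin := fun n => finite_lowDegree (ℛ := ℛ) n
  let π : R →ₗ[K] R ⧸ Ideal.span (Set.range θ) := (Ideal.Quotient.mkₐ K _).toLinearMap
  -- the image of `a` makes `V₂` strictly larger than `V₁`, of dimension at least `dim R₁ + 1 - d`
  let V₁ := (lowDegree ℛ 2).map π
  let V₂ := (lowDegree ℛ (t + 1)).map π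
  have hV : V₁ < V₂ := by
    refine lt_of_le_of_ne (Submodule.map_mono (lowDegree_mono (by omega))) fun h => ?_
    have haV : π a ∈ V₁ := h ▸ Submodule.mem_map_of_mem (mem_lowDegree_of_mem ha (by omega))
    obtain ⟨b, hb, hab⟩ := haV
    have h1 := proj_mem_span_linear hθ (Ideal.Quotient.eq.1 hab) t
    rw [map_sub, mem_lowDegree.1 hb t ht, proj_of_mem ℛ ha, zero_sub] at h1
    exact hcon (neg_mem_iff.1 h1)
  have hlt' := Submodule.finrank_lt_finrank_of_lt hV
  have hV₁ : Module.finrank K (ℛ 1) + 1 ≤ Module.finrank K V₁ + d := by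
    have hrn := LinearMap.finrank_range_add_finrank_ker (π ∘ₗ (lowDegree ℛ 2).subtype)
    rw [LinearMap.range_comp, Submodule.range_subtype, finrank_lowDegree, Finset.sum_range_succ,
      Finset.sum_range_one, finrank_zero h0] at hrn
    have hker : Module.finrank K (LinearMap.ker (π ∘ₗ (lowDegree ℛ 2).subtype)) ≤ d := by
      have : (LinearMap.ker (π ∘ₗ (lowDegree ℛ 2).subtype)).map (lowDegree ℛ 2).subtype ≤
          Submodule.span K (Set.range θ) := by
        rintro _ ⟨r, hr, rfl⟩
        exact mem_span_of_mem_lowDegree_two h0 hθ (Ideal.Quotient.eq_zero_iff_mem.1 hr) r.2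
      have hfs : Module.Finite K (Submodule.span K (Set.range θ)) :=
        Module.Finite.span_of_finite K (Set.finite_range θ)
      have h1 := Submodule.finrank_mono this
      rw [← (Submodule.equivMapOfInjective _ (lowDegree ℛ 2).injective_subtype _).finrank_eq] at h1
      refine h1.trans ?_
      have := finrank_range_le_card (R := K) θ
      rwa [Fintype.card_fin] at this
    have : Module.finrank K V₁ = Module.finrank K ((lowDegree ℛ 2).map π) := rfl
    omega
  let b := Module.finBasis K V₂
  choose e he heb using fun i => (b i).2
  have hind : LinearIndependent K fun i => Ideal.Quotient.mk (Ideal.span (Set.range θ)) (e i) := by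
    have := b.linearIndependent.map' V₂.subtype (Submodule.ker_subtype _)
    convert! this using 1
    ext i
    exact heb i
  have hle := natCast_le_of_tendsto (m := t + 1) (N := Module.finrank K V₂) (fun n =>
    (mul_choose_le_finrank_lowDegree hθ hreg he hind n).trans
      ((finrank_lowDegree (ℛ := ℛ) _).trans_le (hf _))) hE
  have : (Module.finrank K (ℛ 1) : ℝ) + 2 ≤ Module.finrank K V₂ + d := by
    exact_mod_cast (by omega : Module.finrank K (ℛ 1) + 2 ≤ Module.finrank K V₂ + d)
  linarith

end LinearForms

end GradedAlgebra

/-! ### The quotient over an algebraically closed field -/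

/-- A finite type algebra over an algebraically closed field: modulo a maximal ideal every element
is a constant. -/
theorem exists_sub_algebraMap_mem_of_isMaximal {K A : Type*} [Field K] [IsAlgClosed K] [CommRing A]
    [Algebra K A] [Algebra.FiniteType K A] (P : Ideal A) [P.IsMaximal] (x : A) :
    ∃ c : K, x - algebraMap K A c ∈ P := by
  let _ : Field (A ⧸ P) := Ideal.Quotient.field P
  have : Module.Finite K (A ⧸ P) := finite_of_finite_type_of_isJacobsonRing K (A ⧸ P)
  obtain ⟨c, hc⟩ := (IsAlgClosed.algebraMap_bijective_of_isIntegral (k := K) (K := A ⧸ P)).2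
    (Ideal.Quotient.mk P x)
  exact ⟨c, Ideal.Quotient.eq.1 hc.symm⟩

/-- If a flat module over `K[X₁, …, X_d]` carries a compatible structure of module over a
finite type `K[X₁, …, X_d]`-algebra `A`, then it has depth at least `d` at every maximal ideal
of `A`. -/
theorem hasDepth_of_flat_mvPolynomial {K A M : Type*} [Field K] [IsAlgClosed K] [CommRing A]
    [Algebra K A] [Algebra.FiniteType K A] {d : ℕ} [Algebra (MvPolynomial (Fin d) K) A]
    [IsScalarTower K (MvPolynomial (Fin d) K) A] [AddCommGroup M] [Module A M]
    [Module (MvPolynomial (Fin d) K) M] [IsScalarTower (MvPolynomial (Fin d) K) A M]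
    [Module.Flat (MvPolynomial (Fin d) K) M] (P : Ideal A) [P.IsMaximal] : HasDepth P d M := by
  choose a ha using fun i : Fin d => exists_sub_algebraMap_mem_of_isMaximal (K := K) P
    (algebraMap (MvPolynomial (Fin d) K) A (MvPolynomial.X i))
  refine ⟨(List.ofFn fun i => (MvPolynomial.X i - MvPolynomial.C (a i) :
    MvPolynomial (Fin d) K)).map (algebraMap _ A), by simp, ?_, ?_⟩
  · intro r hr
    simp only [List.map_ofFn, List.mem_ofFn', Set.mem_range, Function.comp_apply] at hr
    obtain ⟨i, rfl⟩ := hr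
    have := ha i
    rwa [IsScalarTower.algebraMap_apply K (MvPolynomial (Fin d) K) A, ← map_sub] at this
  · rw [isWeaklyRegular_map_algebraMap_iff]
    exact (LinearEquiv.isWeaklyRegular_congr (TensorProduct.rid _ M) _).1
      ((MvPolynomial.isWeaklyRegular_X_sub_C a).isWeaklyRegular_lTensor (M₂ := M))

/-- If `X` is a basis of `B` and the submodule `N` is spanned by a subset of `X`, then `B/N` is
flat (in fact free, on the remaining basis elements). -/
theorem Module.Flat.quotient_of_span_subset {S B : Type*} [CommRing S] [AddCommGroup B]
    [Module S B] {X E : Set B} (hX : LinearIndepOn S id X) (hEX : E ⊆ X)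
    (htop : Submodule.span S X = ⊤) : Module.Flat S (B ⧸ Submodule.span S E) := by
  have hcompl : IsCompl (Submodule.span S E) (Submodule.span S (X \ E)) := by
    refine ⟨?_, ?_⟩
    · have := LinearIndependent.disjoint_span_image hX (s := Subtype.val ⁻¹' E)
        (t := Subtype.val ⁻¹' (X \ E)) (Set.disjoint_sdiff_right.preimage _)
      have himg : ∀ Y ⊆ X, (fun x : X => id (x : B)) '' (Subtype.val ⁻¹' Y) = Y := fun Y hY => by
        simp [Subtype.image_preimage_coe, hY]
      rwa [himg E hEX, himg _ Set.sdiff_subset] at this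
    · rw [codisjoint_iff, ← Submodule.span_union, Set.union_sdiff_cancel hEX, htop]
  have hli : LinearIndependent S ((↑) : (X \ E : Set B) → B) := hX.mono Set.sdiff_subset
  have : Module.Free S (Submodule.span S (X \ E)) := by
    have hb := Module.Basis.span hli
    rw [Subtype.range_coe] at hb
    exact Module.Free.of_basis hb
  exact Module.Flat.of_linearEquiv (Submodule.quotientEquivOfIsCompl _ _ hcompl)

namespace GradedAlgebra

/-- The heart of the argument, over an algebraically closed field: a homogeneous basis of the image
of `A` in `B/θB` sits in degrees at most one, hence generates `A` over `K[θ]`, and extends to a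
homogeneous `K[θ]`-basis of `B`. So `B/A` is free over `K[θ]`. -/
theorem hasDepth_quotient_range {K A B : Type*} [Field K] [IsAlgClosed K] [CommRing A] [CommRing B]
    [Algebra K A] [Algebra K B] [Algebra A B] [IsScalarTower K A B] [Algebra.FiniteType K A]
    {𝒜 : ℕ → Submodule K A} [GradedAlgebra 𝒜] {ℬ : ℕ → Submodule K B} [GradedAlgebra ℬ]
    (hB : IsPositivelyGraded ℬ)
    (hhom : ∀ i, ∀ a ∈ 𝒜 i, algebraMap A B a ∈ ℬ i) {d : ℕ} {θ : Fin d → A}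
    (hθ : ∀ i, θ i ∈ 𝒜 1)
    (hreg : IsWeaklyRegular B (List.ofFn fun i => algebraMap A B (θ i)))
    (htwo : ∀ t ≥ 2, ∀ a ∈ 𝒜 t, a ∈ Ideal.span (Set.range θ)) (P : Ideal A) [P.IsMaximal] :
    HasDepth P d (B ⧸ LinearMap.range (Algebra.linearMap A B)) := by
  let S := MvPolynomial (Fin d) K
  let _ : Algebra S A := (MvPolynomial.aeval θ : MvPolynomial (Fin d) K →ₐ[K] A).toAlgebra
  have : IsScalarTower K S A := .of_algebraMap_eq' (AlgHom.comp_algebraMap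
    (MvPolynomial.aeval θ : MvPolynomial (Fin d) K →ₐ[K] A)).symm
  let _ : Algebra S B := ((algebraMap A B).comp (algebraMap S A)).toAlgebra
  have : IsScalarTower S A B := .of_algebraMap_eq' rfl
  have : IsScalarTower K S B := .of_algebraMap_eq' (by
    rw [IsScalarTower.algebraMap_eq K A B, IsScalarTower.algebraMap_eq K S A,
      IsScalarTower.algebraMap_eq S A B, RingHom.comp_assoc])
  set η : Fin d → B := fun i => algebraMap A B (θ i) with hη
  have hη1 : ∀ i, η i ∈ ℬ 1 := fun i => hhom 1 _ (hθ i)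
  have halg : ∀ p, algebraMap S B p = MvPolynomial.aeval η p := fun p => by
    rw [IsScalarTower.algebraMap_apply S A B]
    exact (MvPolynomial.aeval_algebraMap_apply B θ p).symm
  have hX : ∀ i, algebraMap S A (MvPolynomial.X i) = θ i := fun i => MvPolynomial.aeval_X θ i
  let π : B →ₗ[K] B ⧸ Ideal.span (Set.range η) := (Ideal.Quotient.mkₐ K _).toLinearMap
  let low : Set B := {b | ∃ i < 2, ∃ a ∈ 𝒜 i, algebraMap A B a = b}
  let hom : Set B := {b | ∃ i, b ∈ ℬ i}
  -- `E` lifts a basis of the image of `A` in degrees at most one, `X ⊇ E` a homogeneous basis of `B/θB`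
  obtain ⟨E, hElow, -, hEspan, hEind⟩ := exists_linearIndepOn_extension
    (linearIndepOn_empty K π) (Set.empty_subset low)
  have hlow : low ⊆ hom := by
    rintro _ ⟨i, -, a, ha, rfl⟩
    exact ⟨i, hhom i a ha⟩
  obtain ⟨X, hXhom, hEX, hXspan, hXind⟩ := exists_linearIndepOn_extension hEind
    (hElow.trans hlow)
  -- spans of homogeneous elements are stable under the projections
  have hproj : ∀ Y ⊆ hom, ∀ w ∈ Submodule.span K Y, ∀ n, proj ℬ n w ∈ Submodule.span K Y := by
    intro Y hY w hw n
    have hle : Submodule.span K Y ≤ (Submodule.span K Y).comap (proj ℬ n) := by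
      refine Submodule.span_le.2 fun y hy => ?_
      obtain ⟨i, hi⟩ := hY hy
      by_cases hin : i = n
      · subst hin
        change proj ℬ i y ∈ Submodule.span K Y
        rw [proj_of_mem ℬ hi]
        exact Submodule.subset_span hy
      · change proj ℬ n y ∈ Submodule.span K Y
        rw [proj_of_mem_of_ne ℬ hi hin]
        exact Submodule.zero_mem _
    exact hle hw
  have hmod : ∀ Y Z : Set B, π '' Z ⊆ Submodule.span K (π '' Y) → ∀ r ∈ Submodule.span K Z,
      ∃ w ∈ Submodule.span K Y, r - w ∈ Ideal.span (Set.range η) := by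
    intro Y Z hYZ r hr
    have h1 : π r ∈ (Submodule.span K Y).map π := by
      rw [Submodule.map_span]
      have h2 := Submodule.mem_map_of_mem (f := π) hr
      rw [Submodule.map_span] at h2
      exact Submodule.span_le.2 hYZ h2
    obtain ⟨w, hw, hwr⟩ := h1
    exact ⟨w, hw, Ideal.Quotient.eq.1 hwr.symm⟩
  have hstable : ∀ N : Submodule S B, ∀ i, ∀ x ∈ N, η i * x ∈ N := fun N i x hx => by
    have := N.smul_mem (MvPolynomial.X i) hx
    rwa [Algebra.smul_def, halg, MvPolynomial.aeval_X] at this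
  have hKS : ∀ Y : Set B, Submodule.span K Y ≤ (Submodule.span S Y).restrictScalars K := fun Y =>
    Submodule.span_le.2 Submodule.subset_span
  -- `X` is a basis of `B` over `S`
  have hXtop : Submodule.span S X = ⊤ := by
    have htop := eq_top_of_stable (N := (Submodule.span S X).restrictScalars K) hη1 (hproj X hXhom)
      (fun r => hmod X hom hXspan r (by
        refine mem_of_forall_proj_mem ℬ _ fun n => Submodule.subset_span ⟨n, proj_mem ℬ n r⟩))
      (hKS X) (fun i x hx => hstable _ i x hx)
    rwa [Submodule.restrictScalars_eq_top_iff] at htop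
  have hXS : LinearIndepOn S id X :=
    linearIndependent_mvPolynomial_of_mod (θ := η) halg hreg hXind
  -- `E` spans the image of `A`
  have hAlow : ∀ i < 2, ∀ a ∈ 𝒜 i, algebraMap A B a ∈ Submodule.span S E := by
    have key : ∀ i < 2, ∀ a ∈ 𝒜 i, ∃ w ∈ Submodule.span K E, ∃ v ∈ Submodule.span K (Set.range η),
        algebraMap A B a = w + v := by
      intro i hi a ha
      obtain ⟨w, hw, hwr⟩ := hmod E low hEspan _ (Submodule.subset_span ⟨i, hi, a, ha, rfl⟩)
      refine ⟨w, hw, _, mem_span_of_mem_lowDegree_two hB hη1 hwr ?_, (add_sub_cancel _ _).symm⟩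
      refine Submodule.sub_mem _ (mem_lowDegree_of_mem (hhom i a ha) hi) ?_
      refine Submodule.span_le.2 ?_ hw
      intro y hy
      obtain ⟨j, hj, b, hb, rfl⟩ := hElow hy
      exact mem_lowDegree_of_mem (hhom j b hb) hj
    have hone : (1 : B) ∈ Submodule.span S E := by
      obtain ⟨w, hw, v, hv, hwv⟩ := key 0 (by omega) 1 SetLike.GradedOne.one_mem
      rw [map_one] at hwv
      have h1 : proj ℬ 0 v = 0 := by
        have : v ∈ ℬ 1 := Submodule.span_le.2 (by rintro _ ⟨i, rfl⟩; exact hη1 i) hv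
        exact proj_of_mem_of_ne ℬ this (by omega)
      have h2 := congrArg (proj ℬ 0) hwv
      rw [proj_of_mem ℬ SetLike.GradedOne.one_mem, map_add, h1, add_zero] at h2
      rw [h2]
      exact hKS E (hproj E (hElow.trans hlow) w hw 0)
    intro i hi a ha
    obtain ⟨w, hw, v, hv, hwv⟩ := key i hi a ha
    rw [hwv]
    refine Submodule.add_mem _ (hKS E hw) ?_
    have hle : Submodule.span K (Set.range η) ≤ (Submodule.span S E).restrictScalars K := by
      refine Submodule.span_le.2 ?_
      rintro _ ⟨j, rfl⟩
      have := hstable _ j 1 hone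
      rwa [mul_one] at this
    exact hle hv
  have hrange : (LinearMap.range (Algebra.linearMap A B)).restrictScalars S =
      Submodule.span S E := by
    apply le_antisymm
    · rintro _ ⟨a, rfl⟩
      let N : Submodule K A := ((Submodule.span S E).restrictScalars K).comap
        (IsScalarTower.toAlgHom K A B).toLinearMap
      have htop : N = ⊤ := by
        refine eq_top_of_stable (ℛ := 𝒜) (W := lowDegree 𝒜 2) hθ ?_ ?_ ?_ ?_
        · intro w hw n
          refine mem_lowDegree.2 fun i hi => ?_
          by_cases hin : n = i
          · rw [hin, proj_of_mem 𝒜 (proj_mem 𝒜 i w), mem_lowDegree.1 hw i hi]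
          · exact proj_of_mem_of_ne 𝒜 (proj_mem 𝒜 n w) hin
        · intro r
          refine ⟨proj 𝒜 0 r + proj 𝒜 1 r, Submodule.add_mem _
            (mem_lowDegree_of_mem (proj_mem 𝒜 0 r) (by omega))
            (mem_lowDegree_of_mem (proj_mem 𝒜 1 r) (by omega)), ?_⟩
          refine mem_of_forall_proj_mem 𝒜 _ fun n => ?_
          rw [map_sub, map_add]
          match n with
          | 0 =>
            rw [proj_of_mem 𝒜 (proj_mem 𝒜 0 r),
              proj_of_mem_of_ne 𝒜 (proj_mem 𝒜 1 r) (by omega), add_zero, sub_self]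
            exact Ideal.zero_mem _
          | 1 =>
            rw [proj_of_mem 𝒜 (proj_mem 𝒜 1 r),
              proj_of_mem_of_ne 𝒜 (proj_mem 𝒜 0 r) (by omega), zero_add, sub_self]
            exact Ideal.zero_mem _
          | n + 2 =>
            rw [proj_of_mem_of_ne 𝒜 (proj_mem 𝒜 0 r) (by omega),
              proj_of_mem_of_ne 𝒜 (proj_mem 𝒜 1 r) (by omega), add_zero, sub_zero]
            exact htwo _ (by omega) _ (proj_mem 𝒜 _ r)
        · intro w hw
          rw [eq_sum_proj_of_mem_lowDegree hw]
          exact N.sum_mem fun i hi =>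
            hAlow i (Finset.mem_range.1 hi) _ (proj_mem 𝒜 i w)
        · intro i x hx
          change algebraMap A B (θ i * x) ∈ Submodule.span S E
          rw [map_mul]
          exact hstable _ i _ hx
      have : a ∈ N := htop ▸ Submodule.mem_top
      exact this
    · refine Submodule.span_le.2 fun y hy => ?_
      obtain ⟨j, hj, b, hb, rfl⟩ := hElow hy
      exact ⟨b, rfl⟩
  have hflat : Module.Flat S (B ⧸ LinearMap.range (Algebra.linearMap A B)) := by
    have := Module.Flat.quotient_of_span_subset hXS hEX hXtop
    rw [← hrange] at this
    exact Module.Flat.of_linearEquiv (Submodule.Quotient.restrictScalarsEquiv S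
      (LinearMap.range (Algebra.linearMap A B))).symm
  exact hasDepth_of_flat_mvPolynomial (K := K) P

end GradedAlgebra

/-! ### Dimension and Cohen–Macaulay rings -/

theorem ringKrullDim_le_of_isIntegral (R S : Type*) [CommRing R] [CommRing S] [Algebra R S]
    [Algebra.IsIntegral R S] : ringKrullDim S ≤ ringKrullDim R :=
  Order.krullDim_le_of_strictMono (PrimeSpectrum.comap (algebraMap R S)) fun _ _ h =>
    Ideal.IsIntegral.comap_lt_comap h

theorem ringKrullDim_le_of_isIntegral_of_injective {R S : Type*} [CommRing R] [CommRing S]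
    [Algebra R S] [Algebra.IsIntegral R S] (hinj : Function.Injective (algebraMap R S)) :
    ringKrullDim R ≤ ringKrullDim S := by
  refine iSup_le fun l => ?_
  have : FaithfulSMul R S := (faithfulSMul_iff_algebraMap_injective R S).2 hinj
  obtain ⟨P, hP⟩ := Algebra.IsIntegral.comap_surjective R S l.head
  have : P.asIdeal.LiesOver l.head.asIdeal := ⟨by rw [← hP]; rfl⟩
  obtain ⟨L, hL, -⟩ := Ideal.exists_ltSeries_of_hasGoingUp l P.asIdeal
  rw [← hL]
  exact le_iSup (fun L : LTSeries (PrimeSpectrum S) => (L.length : WithBot ℕ∞)) L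

namespace HasDepth

variable {R M : Type*} [CommRing R] [AddCommGroup M] [Module R M] {n : ℕ}

/-- Depth at a point of the support bounds the dimension from below: each regular element lowers the
dimension, and Nakayama keeps the quotients nonzero at `p`. -/
theorem le_supportDim [IsNoetherianRing R] [Module.Finite R M] (p : PrimeSpectrum R)
    (hp : p ∈ Module.support R M)
    (h : HasDepth p.asIdeal n M) : (n : WithBot ℕ∞) ≤ Module.supportDim R M := by
  induction n generalizing M with
  | zero =>
    have : Nonempty (Module.support R M) := ⟨⟨p, hp⟩⟩
    exact Order.krullDim_nonneg
  | succ n ih =>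
    obtain ⟨x, hx, hreg, hd⟩ := succ_iff.1 h
    have hp' : p ∈ Module.support R (QuotSMulTop x M) := by
      rw [Module.support_quotSMulTop]
      exact ⟨hp, by simpa [PrimeSpectrum.mem_zeroLocus] using hx⟩
    refine le_trans ?_ (Module.supportDim_quotSMulTop_succ_le_of_notMem_minimalPrimes
      fun _ => hreg.notMem_of_mem_minimalPrimes)
    rw [Nat.cast_add, Nat.cast_one]
    exact add_le_add_left (ih hp' hd) 1

end HasDepth

theorem localDepth_le_supportDim {R M : Type*} [CommRing R] [IsLocalRing R] [IsNoetherianRing R]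
    [AddCommGroup M] [Module R M] [Module.Finite R M] [Nontrivial M] :
    (localDepth R M : WithBot ℕ∞) ≤ Module.supportDim R M := by
  obtain ⟨m, hm⟩ := WithBot.ne_bot_iff_exists.1 (Module.supportDim_ne_bot_of_nontrivial R M)
  rw [← hm, WithBot.coe_le_coe]
  refine iSup₂_le fun rs hrs => ?_
  rw [← WithBot.coe_le_coe, hm]
  exact HasDepth.le_supportDim (IsLocalRing.closedPoint R)
    (IsLocalRing.closedPoint_mem_support R M) ⟨rs, rfl, hrs.2, hrs.1.toIsWeaklyRegular⟩

theorem supportDim_localizedModule_self {R : Type*} [CommRing R] (p : Ideal R) [p.IsPrime] :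
    Module.supportDim (Localization.AtPrime p) (LocalizedModule p.primeCompl R) = p.height := by
  let e : LocalizedModule p.primeCompl R ≃ₗ[Localization.AtPrime p] Localization.AtPrime p :=
    (LocalizedModule.equivTensorProduct p.primeCompl R).trans
      (TensorProduct.AlgebraTensorModule.rid R (Localization.AtPrime p) (Localization.AtPrime p))
  rw [Module.supportDim_eq_of_equiv e, Module.supportDim_self_eq_ringKrullDim,
    IsLocalization.AtPrime.ringKrullDim_eq_height p]

theorem nontrivial_localizedModule_self {R : Type*} [CommRing R] (p : Ideal R) [p.IsPrime] :
    Nontrivial (LocalizedModule p.primeCompl R) := by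
  rw [← Module.supportDim_ne_bot_iff_nontrivial (Localization.AtPrime p),
    supportDim_localizedModule_self]
  exact WithBot.coe_ne_bot

/-- The depth of a Noetherian ring along a prime is at most the height of the prime. -/
theorem HasDepth.le_height {R : Type*} [CommRing R] [IsNoetherianRing R] {n : ℕ} {p : Ideal R}
    [p.IsPrime] (h : HasDepth p n R) : (n : ℕ∞) ≤ p.height := by
  have := nontrivial_localizedModule_self p
  have : Module.Finite (Localization.AtPrime p) (LocalizedModule p.primeCompl R) :=
    Module.Finite.of_isLocalizedModule p.primeCompl (LocalizedModule.mkLinearMap p.primeCompl R)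
  have h1 := localDepth_le_supportDim (R := Localization.AtPrime p)
    (M := LocalizedModule p.primeCompl R)
  rw [supportDim_localizedModule_self, WithBot.coe_le_coe] at h1
  exact (h.le_localDepth p).trans h1

/-- A Cohen–Macaulay ring has depth equal to the height at each maximal ideal, the sequence being
taken in the ring itself and not in its localization. -/
theorem IsCohenMacaulayRing.hasDepth {R : Type*} [CommRing R] (h : IsCohenMacaulayRing R)
    {p : Ideal R} [hp : p.IsMaximal] {n : ℕ} (hn : p.height = n) : HasDepth p n R := by
  have := h.1
  have hnt := nontrivial_localizedModule_self p
  have h1 := h.2.2 ⟨p, hp⟩ (Module.mem_support_iff.2 hnt)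
  refine HasDepth.of_localization p (hasDepth_of_le_localDepth ?_)
  change (localDepth (Localization.AtPrime p) (LocalizedModule p.primeCompl R) : WithBot ℕ∞) =
    Module.supportDim (Localization.AtPrime p) (LocalizedModule p.primeCompl R) at h1
  rw [supportDim_localizedModule_self, hn, WithBot.coe_inj] at h1
  exact h1.ge

/-- A finite module of depth at least `dim R` at every maximal ideal is maximal Cohen–Macaulay. -/
theorem isMaximalCohenMacaulayModule_of_hasDepth {R M : Type*} [CommRing R] [IsNoetherianRing R]
    [AddCommGroup M] [Module R M] [Module.Finite R M] [Nontrivial M] {d : ℕ}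
    (hd : ringKrullDim R = d) (h : ∀ p : Ideal R, p.IsMaximal → HasDepth p d M) :
    IsMaximalCohenMacaulayModule R M := by
  refine ⟨⟨inferInstance, fun p hp => ?_⟩, le_antisymm (Module.supportDim_le_ringKrullDim R M) ?_⟩
  · have : Nontrivial (LocalizedModule p.asIdeal.primeCompl M) := Module.mem_support_iff.1 hp
    have : Module.Finite (Localization.AtPrime p.asIdeal)
        (LocalizedModule p.asIdeal.primeCompl M) :=
      Module.Finite.of_isLocalizedModule p.asIdeal.primeCompl
        (LocalizedModule.mkLinearMap p.asIdeal.primeCompl M)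
    refine le_antisymm localDepth_le_supportDim ?_
    refine (Module.supportDim_le_ringKrullDim _ _).trans ?_
    rw [IsLocalization.AtPrime.ringKrullDim_eq_height p.asIdeal]
    refine le_trans (b := (d : WithBot ℕ∞)) ?_ ?_
    · rw [← hd]
      exact Ideal.height_le_ringKrullDim_of_isPrime
    · exact WithBot.coe_le_coe.2 ((h _ p.isMaximal).le_localDepth p.asIdeal)
  · rw [hd]
    obtain ⟨q, hq⟩ := Module.nonempty_support_of_nontrivial (R := R) (M := M)
    obtain ⟨m, hm, hqm⟩ := q.asIdeal.exists_le_maximal q.2.ne_top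
    exact HasDepth.le_supportDim ⟨m, hm.isPrime⟩ (Module.mem_support_mono hqm hq) (h m hm)

namespace GradedAlgebra

section Homogeneous

variable {k K A R : Type*} [Field k] [Field K] [CommRing A] [CommRing R] [Algebra k A]
  [Algebra K R] [Algebra A R] {𝒜 : ℕ → Submodule k A} [GradedAlgebra 𝒜]
  {ℛ : ℕ → Submodule K R} [GradedAlgebra ℛ]

theorem proj_algebraMap (hhom : ∀ i, ∀ a ∈ 𝒜 i, algebraMap A R a ∈ ℛ i) (n : ℕ) (a : A) :
    proj ℛ n (algebraMap A R a) = algebraMap A R (proj 𝒜 n a) := by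
  induction a using DirectSum.Decomposition.inductionOn 𝒜 with
  | zero => simp
  | @homogeneous i a =>
    by_cases hin : i = n
    · subst hin
      rw [proj_of_mem ℛ (hhom _ _ a.2), proj_of_mem 𝒜 a.2]
    · rw [proj_of_mem_of_ne ℛ (hhom _ _ a.2) hin, proj_of_mem_of_ne 𝒜 a.2 hin, map_zero]
  | add a b ha hb => simp only [map_add, ha, hb]

/-- In an integral homogeneous extension, the irrelevant ideal downstairs generates the irrelevant
ideal upstairs up to radical: for `x` of degree `e`, take the component of
degree `N e` in an integral equation of degree `N`. -/
theorem irrelevant_le_radical_map [Algebra.IsIntegral A R]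
    (hhom : ∀ i, ∀ a ∈ 𝒜 i, algebraMap A R a ∈ ℛ i) :
    (HomogeneousIdeal.irrelevant ℛ).toIdeal ≤
      ((HomogeneousIdeal.irrelevant 𝒜).toIdeal.map (algebraMap A R)).radical := by
  intro r hr
  refine mem_of_forall_proj_mem ℛ _ fun e => ?_
  rcases Nat.eq_zero_or_pos e with rfl | he
  · rw [mem_irrelevant.1 hr]; exact Ideal.zero_mem _
  have hx := proj_mem ℛ e r
  generalize proj ℛ e r = x at hx
  obtain ⟨p, hp, hpx⟩ := Algebra.IsIntegral.isIntegral (R := A) x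
  refine ⟨p.natDegree, ?_⟩
  have hpow : ∀ i, x ^ i ∈ ℛ (i * e) := fun i => by
    simpa using SetLike.pow_mem_graded i hx
  rw [Polynomial.eval₂_eq_sum_range, Finset.sum_range_succ, hp.coeff_natDegree, map_one,
    one_mul] at hpx
  have h1 := congrArg (proj ℛ (p.natDegree * e)) hpx
  rw [map_add, map_zero, proj_of_mem ℛ (hpow _), add_eq_zero_iff_neg_eq, map_sum] at h1
  rw [← h1]
  refine neg_mem (Ideal.sum_mem _ fun i hi => ?_)
  have hi' : i < p.natDegree := Finset.mem_range.1 hi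
  rw [mul_comm (algebraMap A R _), proj_mul_of_mem ℛ (hpow i) (Nat.mul_le_mul_right e hi'.le),
    proj_algebraMap hhom]
  refine Ideal.mul_mem_left _ _ (Ideal.mem_map_of_mem _ (mem_irrelevant.2 ?_))
  refine proj_of_mem_of_ne 𝒜 (proj_mem 𝒜 _ _) ?_
  rw [← Nat.sub_mul]
  exact (Nat.mul_pos (by omega) he).ne'

end Homogeneous

section Parameters

variable {K R : Type*} [Field K] [CommRing R] [Algebra K R] {ℛ : ℕ → Submodule K R}
  [GradedAlgebra ℛ] {d : ℕ} {θ : Fin d → R}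

theorem exists_mem_lowDegree (r : R) : ∃ n, r ∈ lowDegree ℛ n := by
  classical
  refine ⟨(DirectSum.decompose ℛ r).support.sup id + 1, mem_lowDegree.2 fun i hi => ?_⟩
  by_contra hne
  have hmem : i ∈ (DirectSum.decompose ℛ r).support :=
    DFinsupp.mem_support_iff.2 fun h => hne (congrArg Subtype.val h)
  have : i ≤ (DirectSum.decompose ℛ r).support.sup id := Finset.le_sup (f := id) hmem
  omega

/-- A regular sequence of `ht 𝔪` linear forms generates an `𝔪`-primary ideal: a prime inside `𝔪`
that contains the forms has height at least `ht 𝔪`, hence is `𝔪`, whereas a homogeneous element of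
`𝔪` with no power in the ideal would be avoided by such a prime. -/
theorem irrelevant_le_radical_span [IsNoetherianRing R] (h0 : IsPositivelyGraded ℛ)
    (hθ : ∀ i, θ i ∈ ℛ 1) (hreg : IsWeaklyRegular R (List.ofFn θ))
    (hht : (HomogeneousIdeal.irrelevant ℛ).toIdeal.height ≤ d) :
    (HomogeneousIdeal.irrelevant ℛ).toIdeal ≤ (Ideal.span (Set.range θ)).radical := by
  intro r hr
  have hmax := irrelevant_isMaximal h0
  refine mem_of_forall_proj_mem ℛ _ fun e => ?_
  rcases Nat.eq_zero_or_pos e with rfl | he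
  · rw [mem_irrelevant.1 hr]; exact Ideal.zero_mem _
  have hx := proj_mem ℛ e r
  generalize proj ℛ e r = x at hx
  by_contra hcon
  have hdisj : Disjoint (Ideal.span (Set.range θ) : Set R)
      ((HomogeneousIdeal.irrelevant ℛ).toIdeal.primeCompl ⊔ Submonoid.powers x : Submonoid R) := by
    rw [Set.disjoint_left]
    rintro y hy hy'
    obtain ⟨s, hs, _, ⟨N, rfl⟩, rfl⟩ := Submonoid.mem_sup.1 hy'
    refine hcon ⟨N, ?_⟩
    -- the component of `s * x ^ N` in the degree of `x ^ N` is a nonzero constant times `x ^ N`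
    have hpow : x ^ N ∈ ℛ (N * e) := by simpa using SetLike.pow_mem_graded N hx
    have h1 := proj_mem_span_linear hθ hy (N * e)
    change proj ℛ (N * e) (s * x ^ N) ∈ _ at h1
    rw [mul_comm s, proj_mul_of_mem ℛ hpow le_rfl, Nat.sub_self] at h1
    obtain ⟨c, hc⟩ := exists_proj_zero_eq h0 s
    have hc0 : c ≠ 0 := by
      rintro rfl
      exact hs (mem_irrelevant.2 (by rw [hc, map_zero]))
    rw [hc] at h1
    have h2 := Ideal.mul_mem_right (algebraMap K R c⁻¹) _ h1
    rwa [mul_assoc, ← map_mul, mul_inv_cancel₀ hc0, map_one, mul_one] at h2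
  obtain ⟨Q, hQ, hθQ, hQd⟩ := Ideal.exists_le_prime_disjoint _ _ hdisj
  have hQle : Q < (HomogeneousIdeal.irrelevant ℛ).toIdeal := by
    refine lt_of_le_of_ne (fun y hy => ?_) ?_
    · by_contra hy'
      exact Set.disjoint_left.1 hQd hy ((le_sup_left : _ ≤ _ ⊔ Submonoid.powers x) hy')
    · rintro rfl
      refine Set.disjoint_left.1 hQd ?_
        ((le_sup_right : Submonoid.powers x ≤ _) (Submonoid.mem_powers x))
      exact mem_irrelevant.2 (proj_of_mem_of_ne ℛ hx he.ne')
  have h1 := Ideal.height_strict_mono_of_isPrime_of_isPrime hQle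
  have h2 : HasDepth Q d R := by
    refine ⟨List.ofFn θ, by simp, fun r hr => hθQ ?_, hreg⟩
    exact Ideal.subset_span (by simpa [List.mem_ofFn'] using hr)
  exact absurd (h2.le_height.trans_lt h1) (not_lt.2 hht)

/-- If linear forms `θ` generate an ideal primary to the irrelevant ideal, then `R` is finite over
`K[θ]`; in particular its dimension is at most the number of forms. -/
theorem ringKrullDim_le_of_irrelevant_le_radical [IsNoetherianRing R]
    (h0 : IsPositivelyGraded ℛ) (hθ : ∀ i, θ i ∈ ℛ 1)
    (hrad : (HomogeneousIdeal.irrelevant ℛ).toIdeal ≤ (Ideal.span (Set.range θ)).radical) :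
    ringKrullDim R ≤ d := by
  have := finiteType h0
  have := fun i => finite_piece h0 i
  have hfin : Module.Finite K (R ⧸ Ideal.span (Set.range θ)) := by
    have : Algebra.IsIntegral K (R ⧸ Ideal.span (Set.range θ)) := by
      refine ⟨fun y => ?_⟩
      obtain ⟨r, rfl⟩ := Ideal.Quotient.mk_surjective y
      obtain ⟨c, hc⟩ := exists_proj_zero_eq h0 r
      have hrc : r - algebraMap K R c ∈ (HomogeneousIdeal.irrelevant ℛ).toIdeal := by
        rw [mem_irrelevant, map_sub, hc, proj_of_mem ℛ (SetLike.algebraMap_mem_graded ℛ c),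
          sub_self]
      obtain ⟨N, hN⟩ := hrad hrc
      refine ⟨(Polynomial.X - Polynomial.C c) ^ N, (Polynomial.monic_X_sub_C c).pow N, ?_⟩
      rw [← Polynomial.aeval_def, map_pow, map_sub, Polynomial.aeval_X, Polynomial.aeval_C,
        IsScalarTower.algebraMap_apply K R, ← Ideal.Quotient.mk_eq_mk]
      rw [← Ideal.Quotient.eq_zero_iff_mem] at hN
      rw [← hN, map_pow, map_sub]
      rfl
    exact Algebra.IsIntegral.finite
  -- `R` is spanned modulo `θ` by its part of low degree, as `R/θR` is finite-dimensional
  obtain ⟨n, hn⟩ : ∃ n, ∀ r : R, ∃ w ∈ lowDegree ℛ n, r - w ∈ Ideal.span (Set.range θ) := by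
    obtain ⟨s, hs⟩ := hfin
    choose lift hlift using Ideal.Quotient.mk_surjective (I := Ideal.span (Set.range θ))
    choose deg hdeg using exists_mem_lowDegree (ℛ := ℛ)
    let n := s.sup fun y => deg (lift y)
    refine ⟨n, fun r => ?_⟩
    have htop : (lowDegree ℛ n).map (Ideal.Quotient.mkₐ K (Ideal.span (Set.range θ))).toLinearMap =
        ⊤ := by
      rw [eq_top_iff, ← hs, Submodule.span_le]
      intro y hy
      exact ⟨lift y, lowDegree_mono (Finset.le_sup (f := fun y => deg (lift y)) hy) (hdeg _),
        hlift y⟩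
    obtain ⟨w, hw, hwr⟩ := htop.ge (Submodule.mem_top (x := Ideal.Quotient.mk _ r))
    exact ⟨w, hw, Ideal.Quotient.eq.1 hwr.symm⟩
  let S := MvPolynomial (Fin d) K
  let _ : Algebra S R := (MvPolynomial.aeval θ : MvPolynomial (Fin d) K →ₐ[K] R).toAlgebra
  have : IsScalarTower K S R := .of_algebraMap_eq' (AlgHom.comp_algebraMap
    (MvPolynomial.aeval θ : MvPolynomial (Fin d) K →ₐ[K] R)).symm
  have halg : ∀ i, algebraMap S R (MvPolynomial.X i) = θ i := fun i => MvPolynomial.aeval_X θ i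
  obtain ⟨s, hs⟩ := Module.Finite.iff_fg.1 (finite_lowDegree (ℛ := ℛ) n)
  have htop := eq_top_of_stable (N := (Submodule.span S (s : Set R)).restrictScalars K)
    (W := lowDegree ℛ n) hθ (fun w hw m => mem_lowDegree.2 fun i hi => by
      by_cases hin : m = i
      · rw [hin, proj_of_mem ℛ (proj_mem ℛ i w), mem_lowDegree.1 hw i hi]
      · exact proj_of_mem_of_ne ℛ (proj_mem ℛ m w) hin) hn
    (by rw [← hs]; exact Submodule.span_le.2 Submodule.subset_span)
    (fun i x hx => by
      have := (Submodule.span S (s : Set R)).smul_mem (MvPolynomial.X i) hx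
      rwa [Algebra.smul_def, halg] at this)
  rw [Submodule.restrictScalars_eq_top_iff] at htop
  have : Module.Finite S R := ⟨s, htop⟩
  have h1 := ringKrullDim_le_of_isIntegral S R
  rwa [MvPolynomial.ringKrullDim_of_isNoetherianRing, ringKrullDim_eq_zero_of_field, zero_add,
    Nat.card_fin] at h1

end Parameters

end GradedAlgebra

/-! ### Extension of the base field -/

attribute [local instance] Algebra.TensorProduct.rightAlgebra

theorem List.map_eq_ofFn_get {α β : Type*} (f : α → β) (l : List α) :
    l.map f = List.ofFn fun i => f (l.get i) := by
  conv_lhs => rw [← List.ofFn_get l, List.map_ofFn]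
  rfl

theorem isIntegral_tensorProduct_right (k K R : Type*) [Field k] [Field K] [Algebra k K]
    [Algebra.IsIntegral k K] [CommRing R] [Algebra k R] : Algebra.IsIntegral R (K ⊗[k] R) := by
  refine ⟨fun x => ?_⟩
  induction x with
  | zero => exact isIntegral_zero
  | tmul c r =>
    have h1 : IsIntegral R (c ⊗ₜ[k] (1 : R)) :=
      ((Algebra.IsIntegral.isIntegral (R := k) c).map
        (Algebra.TensorProduct.includeLeft : K →ₐ[k] K ⊗[k] R)).tower_top
    have h2 : IsIntegral R ((1 : K) ⊗ₜ[k] r) := isIntegral_algebraMap (x := r)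
    simpa using h1.mul h2
  | add x y hx hy => exact hx.add hy

theorem flat_tensorProduct_right (k K R : Type*) [Field k] [Field K] [Algebra k K]
    [CommRing R] [Algebra k R] : Module.Flat R (K ⊗[k] R) :=
  Module.Flat.isBaseChange k R K (K ⊗[k] R)
    (Algebra.IsPushout.out (R := k) (S := R) (R' := K) (S' := K ⊗[k] R))

theorem injective_algebraMap_tensorProduct_right (k K R : Type*) [Field k] [Field K] [Algebra k K]
    [CommRing R] [Algebra k R] : Function.Injective (algebraMap R (K ⊗[k] R)) :=
  Algebra.TensorProduct.includeRight_injective (algebraMap k K).injective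

namespace GradedAlgebra

theorem algebraMap_mem_baseChange {k R : Type*} (K : Type*) [Field k] [Field K] [Algebra k K]
    [CommRing R] [Algebra k R] {ℛ : ℕ → Submodule k R} (i : ℕ) (r : R) (hr : r ∈ ℛ i) :
    algebraMap R (K ⊗[k] R) r ∈ (ℛ i).baseChange K :=
  Submodule.tmul_mem_baseChange_of_mem _ hr

section BaseChange

variable {k R : Type*} (K : Type*) [Field k] [Field K] [Algebra k K] [CommRing R] [Algebra k R]
  {ℛ : ℕ → Submodule k R} [GradedAlgebra ℛ]

theorem isPositivelyGraded_baseChange (h0 : IsPositivelyGraded ℛ) :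
    IsPositivelyGraded fun i => (ℛ i).baseChange K := by
  have := nontrivial_of_isPositivelyGraded h0
  refine ⟨fun a b hab => ?_, fun ⟨y, hy⟩ => ?_⟩
  · exact (algebraMap K (K ⊗[k] R)).injective (congrArg Subtype.val hab)
  · have key : ∀ x : K ⊗[k] ℛ 0, ∃ c : K,
        algebraMap K (K ⊗[k] R) c = ((ℛ 0).toBaseChange K x : K ⊗[k] R) := by
      intro x
      induction x with
      | zero => exact ⟨0, by simp⟩
      | tmul c r =>
        obtain ⟨a, ha⟩ := exists_algebraMap_eq h0 r.2
        refine ⟨a • c, ?_⟩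
        rw [Submodule.coe_toBaseChange_tmul, ← ha, Algebra.algebraMap_eq_smul_one (R := k),
          ← TensorProduct.smul_tmul]
        rfl
      | add x y hx hy =>
        obtain ⟨c, hc⟩ := hx
        obtain ⟨c', hc'⟩ := hy
        exact ⟨c + c', by rw [map_add, hc, hc', map_add]; rfl⟩
    obtain ⟨x, rfl⟩ := Submodule.toBaseChange_surjective' K _ hy
    obtain ⟨c, hc⟩ := key x
    exact ⟨c, Subtype.ext hc⟩

variable (ℛ) in
theorem finrank_baseChange_piece (i : ℕ) :
    Module.finrank K ((ℛ i).baseChange K) = Module.finrank k (ℛ i) := by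
  rw [← (LinearEquiv.ofBijective _ (DirectSum.toBaseChange_bijective (S := K) ℛ i)).finrank_eq,
    Module.finrank_baseChange]

theorem comap_irrelevant_baseChange :
    (HomogeneousIdeal.irrelevant fun i => (ℛ i).baseChange K).toIdeal.comap
      (algebraMap R (K ⊗[k] R)) = (HomogeneousIdeal.irrelevant ℛ).toIdeal := by
  ext r
  rw [Ideal.mem_comap, mem_irrelevant, mem_irrelevant,
    proj_algebraMap (𝒜 := ℛ) (algebraMap_mem_baseChange K),
    map_eq_zero_iff _ (injective_algebraMap_tensorProduct_right k K R)]

theorem irrelevant_baseChange_le_map :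
    (HomogeneousIdeal.irrelevant fun i => (ℛ i).baseChange K).toIdeal ≤
      (HomogeneousIdeal.irrelevant ℛ).toIdeal.map (algebraMap R (K ⊗[k] R)) := by
  intro x hx
  refine mem_of_forall_proj_mem (fun i => (ℛ i).baseChange K) _ fun n => ?_
  rcases Nat.eq_zero_or_pos n with rfl | hn
  · rw [mem_irrelevant.1 hx]; exact Ideal.zero_mem _
  have h := proj_mem (fun i => (ℛ i).baseChange K) n x
  generalize proj (fun i => (ℛ i).baseChange K) n x = y at h
  obtain ⟨y, rfl⟩ := Submodule.toBaseChange_surjective' K _ h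
  clear h
  induction y with
  | zero => simp
  | tmul c r =>
    rw [Submodule.coe_toBaseChange_tmul]
    have : c ⊗ₜ[k] (r : R) = (c ⊗ₜ[k] (1 : R)) * algebraMap R (K ⊗[k] R) r := by
      change _ = (c ⊗ₜ[k] (1 : R)) * ((1 : K) ⊗ₜ[k] (r : R))
      simp
    rw [this]
    exact Ideal.mul_mem_left _ _ (Ideal.mem_map_of_mem _
      (mem_irrelevant.2 (proj_of_mem_of_ne ℛ r.2 hn.ne')))
  | add y z hy hz =>
    rw [map_add]
    exact Ideal.add_mem _ hy hz

theorem isNoetherianRing_baseChange [IsNoetherianRing R] (h0 : IsPositivelyGraded ℛ) :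
    IsNoetherianRing (K ⊗[k] R) := by
  have := finiteType h0
  exact Algebra.FiniteType.isNoetherianRing K _

/-- The height of the irrelevant ideal does not grow under extension of the base field, because the
fibre over it is a field. -/
theorem height_irrelevant_baseChange_le [IsNoetherianRing R] (h0 : IsPositivelyGraded ℛ) :
    (HomogeneousIdeal.irrelevant fun i => (ℛ i).baseChange K).toIdeal.height ≤
      (HomogeneousIdeal.irrelevant ℛ).toIdeal.height := by
  have := isNoetherianRing_baseChange K h0
  have := irrelevant_isMaximal h0
  have := irrelevant_isMaximal (isPositivelyGraded_baseChange K h0)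
  have : (HomogeneousIdeal.irrelevant fun i => (ℛ i).baseChange K).toIdeal.LiesOver
      (HomogeneousIdeal.irrelevant ℛ).toIdeal := ⟨(comap_irrelevant_baseChange K).symm⟩
  have h1 := Ideal.height_le_height_add_of_liesOver (HomogeneousIdeal.irrelevant ℛ).toIdeal
    (HomogeneousIdeal.irrelevant fun i => (ℛ i).baseChange K).toIdeal
  have h2 : (HomogeneousIdeal.irrelevant fun i => (ℛ i).baseChange K).toIdeal.map
      (Ideal.Quotient.mk ((HomogeneousIdeal.irrelevant ℛ).toIdeal.map
        (algebraMap R (K ⊗[k] R)))) = ⊥ := by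
    rw [Ideal.map_eq_bot_iff_le_ker, Ideal.mk_ker]
    exact irrelevant_baseChange_le_map K
  have h3 : Nontrivial ((K ⊗[k] R) ⧸ (HomogeneousIdeal.irrelevant ℛ).toIdeal.map
      (algebraMap R (K ⊗[k] R))) := by
    refine Ideal.Quotient.nontrivial_iff.2 fun h => Ideal.IsPrime.ne_top
      (I := (HomogeneousIdeal.irrelevant fun i => (ℛ i).baseChange K).toIdeal) inferInstance ?_
    rw [eq_top_iff, ← h, Ideal.map_le_iff_le_comap, comap_irrelevant_baseChange]
  rwa [h2, Ideal.height_bot, add_zero] at h1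

end BaseChange

section Depth

variable {k A R : Type*} (K : Type*) [Field k] [Field K] [Algebra k K] [CommRing A] [Algebra k A]
  [CommRing R] [Algebra k R] [Algebra A R] [IsScalarTower k A R]
  {𝒜 : ℕ → Submodule k A} {ℛ : ℕ → Submodule k R}

variable (𝒜 R) in
/-- The linear forms of `K ⊗ A`, viewed as elements of `K ⊗ R`. -/
noncomputable def linearFormsMap : (𝒜 1).baseChange K →ₗ[K] K ⊗[k] R :=
  (Algebra.TensorProduct.map (AlgHom.id K K)
    (IsScalarTower.toAlgHom k A R)).toLinearMap ∘ₗ ((𝒜 1).baseChange K).subtype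

theorem linearFormsMap_mem (hhom : ∀ i, ∀ a ∈ 𝒜 i, algebraMap A R a ∈ ℛ i)
    (v : (𝒜 1).baseChange K) : linearFormsMap R K 𝒜 v ∈ (ℛ 1).baseChange K := by
  obtain ⟨y, rfl⟩ := Submodule.toBaseChange_surjective K _ v
  induction y with
  | zero => simp
  | tmul c a => exact Submodule.tmul_mem_baseChange_of_mem _ (hhom 1 a a.2)
  | add y z hy hz =>
    rw [map_add, map_add]
    exact Submodule.add_mem _ hy hz

variable [GradedAlgebra 𝒜] [GradedAlgebra ℛ]

/-- A Cohen–Macaulay graded ring `R` of dimension `d`, integral over a standard graded ring `A`,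
has depth at least `d` along the ideal generated by the linear forms of `A`, even after extension
of the base field. -/
theorem hasDepth_span_linearFormsMap [Algebra.IsIntegral k K] [Infinite K]
    (hstd : IsStandardGraded 𝒜) (hR : IsPositivelyGraded ℛ) (hCM : IsCohenMacaulayRing R)
    [Algebra.IsIntegral A R] (hhom : ∀ i, ∀ a ∈ 𝒜 i, algebraMap A R a ∈ ℛ i) {d : ℕ}
    (hd : ringKrullDim R = d) :
    HasDepth (Ideal.span (Set.range (linearFormsMap R K 𝒜))) d (K ⊗[k] R) := by
  have := hCM.1
  have hmax := irrelevant_isMaximal hR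
  have := isNoetherianRing_baseChange K hR
  have := flat_tensorProduct_right k K R
  have := isIntegral_tensorProduct_right k K R
  obtain ⟨h, hh⟩ := ENat.ne_top_iff_exists.1
    ((HomogeneousIdeal.irrelevant ℛ).toIdeal.height_ne_top Ideal.IsPrime.ne_top')
  have h1 := ((hCM.hasDepth hh.symm).of_le_radical
    (irrelevant_le_radical_map hhom)).map_of_isBaseChange
      (IsBaseChange.linearMap R (K ⊗[k] R))
  have hle : ((HomogeneousIdeal.irrelevant 𝒜).toIdeal.map (algebraMap A R)).map
      (algebraMap R (K ⊗[k] R)) ≤ Ideal.span (Set.range (linearFormsMap R K 𝒜)) := by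
    rw [irrelevant_eq_span_one hstd, Ideal.map_span, Ideal.map_span, Ideal.span_le]
    rintro _ ⟨_, ⟨a, ha, rfl⟩, rfl⟩
    exact Ideal.subset_span ⟨⟨_, Submodule.tmul_mem_baseChange_of_mem 1 ha⟩, rfl⟩
  have h2 := h1.of_le_radical (hle.trans Ideal.le_radical)
  -- it remains to see `d ≤ h`: `K ⊗ R` has a regular sequence of `h` linear forms, hence dimension
  -- at most `h`, and `R` is contained in it integrally
  refine h2.of_le ?_
  obtain ⟨vs, hvs, hreg, -⟩ := HasDepth.exists_generic_isWeaklyRegular _ _ h2 h2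
  subst hvs
  have hθ := fun i => linearFormsMap_mem K hhom (vs.get i)
  rw [List.map_eq_ofFn_get] at hreg
  have h3 := ringKrullDim_le_of_irrelevant_le_radical (ℛ := fun i => (ℛ i).baseChange K)
    (isPositivelyGraded_baseChange K hR) hθ
    (irrelevant_le_radical_span (ℛ := fun i => (ℛ i).baseChange K)
      (isPositivelyGraded_baseChange K hR) hθ hreg
      ((height_irrelevant_baseChange_le K hR).trans hh.ge))
  have h4 := (ringKrullDim_le_of_isIntegral_of_injective
    (injective_algebraMap_tensorProduct_right k K R)).trans h3
  rw [hd] at h4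
  exact_mod_cast h4

end Depth

end GradedAlgebra

section QuotientBaseChange

variable {k K A B : Type*} [Field k] [Field K] [Algebra k K] [CommRing A] [Algebra k A]
  [CommRing B] [Algebra k B] [Algebra A B] [IsScalarTower k A B]
  [Algebra (K ⊗[k] A) (K ⊗[k] B)]

/-- The formation of `B/A` commutes with extension of the base field. -/
theorem nonempty_tensorProduct_quotient_range_equiv
    (halg : ∀ (c : K) (a : A), algebraMap (K ⊗[k] A) (K ⊗[k] B) (c ⊗ₜ a) = c ⊗ₜ algebraMap A B a) :
    Nonempty ((K ⊗[k] A) ⊗[A] (B ⧸ LinearMap.range (Algebra.linearMap A B)) ≃ₗ[K ⊗[k] A]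
      (K ⊗[k] B) ⧸ LinearMap.range (Algebra.linearMap (K ⊗[k] A) (K ⊗[k] B))) := by
  let N := (K ⊗[k] B) ⧸ LinearMap.range (Algebra.linearMap (K ⊗[k] A) (K ⊗[k] B))
  let _ : Module A N := Module.compHom N (algebraMap A (K ⊗[k] A))
  have : IsScalarTower A (K ⊗[k] A) N := IsScalarTower.of_algebraMap_smul fun _ _ => rfl
  let q : K ⊗[k] B →ₗ[K ⊗[k] A] N := Submodule.mkQ _
  let π : B →ₗ[A] B ⧸ LinearMap.range (Algebra.linearMap A B) := Submodule.mkQ _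
  have hsmul : ∀ (c c' : K) (a : A) (b : B),
      (c ⊗ₜ[k] a) • (c' ⊗ₜ[k] b : K ⊗[k] B) = (c * c') ⊗ₜ (a • b) := fun c c' a b => by
    rw [Algebra.smul_def, halg, Algebra.TensorProduct.tmul_mul_tmul, Algebra.smul_def]
  let g₀ : B →ₗ[A] N :=
    { toFun := fun b => q (1 ⊗ₜ b)
      map_add' := fun b b' => by rw [TensorProduct.tmul_add, map_add]
      map_smul' := fun a b => by
        have : (1 : K) ⊗ₜ[k] (a • b) = ((1 : K) ⊗ₜ[k] a) • ((1 : K) ⊗ₜ[k] b) := by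
          rw [hsmul, one_mul]
        rw [this, map_smul]
        rfl }
  let g : (B ⧸ LinearMap.range (Algebra.linearMap A B)) →ₗ[A] N :=
    Submodule.liftQ _ g₀ (by
      rintro _ ⟨a, rfl⟩
      refine (Submodule.Quotient.mk_eq_zero _).2 ⟨1 ⊗ₜ a, ?_⟩
      exact halg 1 a)
  let F : (K ⊗[k] A) ⊗[A] (B ⧸ LinearMap.range (Algebra.linearMap A B)) →ₗ[K ⊗[k] A] N :=
    g.liftBaseChange (K ⊗[k] A)
  have hF : ∀ s b, F (s ⊗ₜ π b) = s • q (1 ⊗ₜ b) := fun s b => by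
    rw [LinearMap.liftBaseChange_tmul]
    rfl
  -- the inverse, `c ⊗ b ↦ (c ⊗ 1) ⊗ b`; only its additivity is needed
  let G₁ : K →+ B →+ (K ⊗[k] A) ⊗[A] (B ⧸ LinearMap.range (Algebra.linearMap A B)) :=
    { toFun := fun c =>
        { toFun := fun b => (c ⊗ₜ[k] (1 : A)) ⊗ₜ[A] π b
          map_zero' := by rw [map_zero, TensorProduct.tmul_zero]
          map_add' := fun b b' => by rw [map_add, TensorProduct.tmul_add] }
      map_zero' := by
        ext b
        change ((0 : K) ⊗ₜ[k] (1 : A)) ⊗ₜ[A] π b = 0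
        rw [TensorProduct.zero_tmul, TensorProduct.zero_tmul]
      map_add' := fun c c' => by
        ext b
        change ((c + c') ⊗ₜ[k] (1 : A)) ⊗ₜ[A] π b = _
        rw [TensorProduct.add_tmul, TensorProduct.add_tmul]
        rfl }
  let G₀ : K ⊗[k] B →+ (K ⊗[k] A) ⊗[A] (B ⧸ LinearMap.range (Algebra.linearMap A B)) :=
    TensorProduct.liftAddHom G₁ fun r c b => by
      change ((r • c) ⊗ₜ[k] (1 : A)) ⊗ₜ[A] π b = (c ⊗ₜ[k] (1 : A)) ⊗ₜ[A] π (r • b)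
      rw [← algebraMap_smul A r b, map_smul, ← TensorProduct.smul_tmul,
        Algebra.smul_def (algebraMap k A r)]
      congr 1
      change _ = ((1 : K) ⊗ₜ[k] algebraMap k A r) * _
      rw [Algebra.TensorProduct.tmul_mul_tmul, one_mul, mul_one,
        Algebra.algebraMap_eq_smul_one (A := A), ← TensorProduct.smul_tmul]
  have hG₀ : ∀ c b, G₀ (c ⊗ₜ b) = (c ⊗ₜ[k] (1 : A)) ⊗ₜ[A] π b := fun _ _ => rfl
  have hker : ∀ x, G₀ (algebraMap (K ⊗[k] A) (K ⊗[k] B) x) = 0 := by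
    intro x
    induction x with
    | zero => simp
    | tmul c a =>
      have : π (algebraMap A B a) = 0 := (Submodule.Quotient.mk_eq_zero _).2 ⟨a, rfl⟩
      rw [halg, hG₀, this, TensorProduct.tmul_zero]
    | add x y hx hy => rw [map_add, map_add, hx, hy, add_zero]
  let G : N →+ (K ⊗[k] A) ⊗[A] (B ⧸ LinearMap.range (Algebra.linearMap A B)) :=
    QuotientAddGroup.lift (LinearMap.range (Algebra.linearMap (K ⊗[k] A)
      (K ⊗[k] B))).toAddSubgroup G₀ (by
        rintro _ ⟨x, rfl⟩
        exact hker x)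
  have hG : ∀ x, G (q x) = G₀ x := fun _ => rfl
  have hGF : ∀ x, G (F x) = x := by
    intro x
    induction x with
    | zero => rw [map_zero, map_zero]
    | tmul s m =>
      obtain ⟨b, rfl⟩ := Submodule.mkQ_surjective _ m
      change G (F (s ⊗ₜ π b)) = s ⊗ₜ π b
      rw [hF]
      induction s with
      | zero => rw [zero_smul, map_zero, TensorProduct.zero_tmul]
      | tmul c a =>
        rw [← map_smul, hsmul, mul_one, hG, hG₀, map_smul, ← TensorProduct.smul_tmul,
          Algebra.smul_def]
        congr 1
        change ((1 : K) ⊗ₜ[k] a) * _ = _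
        rw [Algebra.TensorProduct.tmul_mul_tmul, one_mul, mul_one]
      | add s t hs ht => rw [add_smul, map_add, hs, ht, TensorProduct.add_tmul]
    | add x y hx hy => rw [map_add, map_add, hx, hy]
  refine ⟨LinearEquiv.ofBijective F ⟨Function.LeftInverse.injective hGF, fun y => ?_⟩⟩
  obtain ⟨x, rfl⟩ := Submodule.mkQ_surjective _ y
  change ∃ z, F z = q x
  induction x with
  | zero => exact ⟨0, by rw [map_zero, map_zero]⟩
  | tmul c b =>
    refine ⟨(c ⊗ₜ 1) ⊗ₜ π b, ?_⟩
    rw [hF, ← map_smul, hsmul, mul_one, one_smul]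
  | add x y hx hy =>
    obtain ⟨z, hz⟩ := hx
    obtain ⟨w, hw⟩ := hy
    exact ⟨z + w, by rw [map_add, map_add, hz, hw]⟩

end QuotientBaseChange

namespace GradedAlgebra

theorem finite_of_isIntegral {k A B : Type*} [Field k] [CommRing A] [CommRing B] [Algebra k A]
    [Algebra k B] [Algebra A B] [IsScalarTower k A B] [Algebra.IsIntegral A B]
    {ℬ : ℕ → Submodule k B} [GradedAlgebra ℬ] (hN : IsNoetherianRing B)
    (hB : IsPositivelyGraded ℬ) : Module.Finite A B := by
  have : Algebra.FiniteType k B := finiteType hB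
  have : Algebra.FiniteType A B := Algebra.FiniteType.of_restrictScalars_finiteType k A B
  exact Algebra.IsIntegral.finite

/-- Depth of `B/A` at the maximal ideals of `A`, by passage to the algebraic closure of the base
field, where regular sequences of linear forms exist. -/
theorem hasDepth_quotient_range_of_hasMinimalMultiplicity {k A B : Type*} [Field k] [CommRing A]
    [CommRing B] [Algebra k A] [Algebra k B] [Algebra A B] [IsScalarTower k A B]
    {𝒜 : ℕ → Submodule k A} [GradedAlgebra 𝒜] {ℬ : ℕ → Submodule k B} [GradedAlgebra ℬ]
    (hB : IsPositivelyGraded ℬ) (hACM : IsCohenMacaulayRing A) (hBCM : IsCohenMacaulayRing B)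
    (hinj : Function.Injective (algebraMap A B))
    (hhom : ∀ i, ∀ a ∈ 𝒜 i, algebraMap A B a ∈ ℬ i) [Algebra.IsIntegral A B]
    (hstd : IsStandardGraded 𝒜) {d : ℕ}
    (hmul : HasDimAndMultiplicity 𝒜 d ((gradedEmbDim 𝒜 : ℝ) - d + 1))
    (p : Ideal A) [hp : p.IsMaximal] :
    HasDepth p d (B ⧸ LinearMap.range (Algebra.linearMap A B)) := by
  let K := AlgebraicClosure k
  have hAN := hACM.1
  have hBd : ringKrullDim B = d := by
    rw [← hmul.1]
    exact le_antisymm (ringKrullDim_le_of_isIntegral A B)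
      (ringKrullDim_le_of_isIntegral_of_injective hinj)
  have : IsNoetherianRing (K ⊗[k] A) := isNoetherianRing_baseChange K hstd.1
  have : IsNoetherianRing (K ⊗[k] B) := by
    have := hBCM.1
    exact isNoetherianRing_baseChange K hB
  have : Algebra.FiniteType k A := finiteType hstd.1
  obtain ⟨vs, hvs, hregA, hregB⟩ := HasDepth.exists_generic_isWeaklyRegular _ _
    (hasDepth_span_linearFormsMap K hstd hstd.1 hACM (fun _ _ h => h) hmul.1)
    (hasDepth_span_linearFormsMap K hstd hB hBCM hhom hBd)
  subst hvs
  let _ : Algebra (K ⊗[k] A) (K ⊗[k] B) := (Algebra.TensorProduct.map (AlgHom.id K K)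
    (IsScalarTower.toAlgHom k A B)).toAlgebra
  have : IsScalarTower K (K ⊗[k] A) (K ⊗[k] B) := .of_algebraMap_eq' (AlgHom.comp_algebraMap
    (Algebra.TensorProduct.map (AlgHom.id K K) (IsScalarTower.toAlgHom k A B))).symm
  let θ : Fin vs.length → K ⊗[k] A := fun i => vs.get i
  have hθ : ∀ i, θ i ∈ (𝒜 1).baseChange K := fun i => (vs.get i).2
  have hregA' : IsWeaklyRegular (K ⊗[k] A) (List.ofFn θ) := by
    rw [List.map_eq_ofFn_get] at hregA
    convert hregA using 3
    exact (DFunLike.congr_fun (Algebra.TensorProduct.map_id (R := k) (S := K) (A := K) (B := A))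
      _).symm
  have hregB' : IsWeaklyRegular (K ⊗[k] B)
      (List.ofFn fun i => algebraMap (K ⊗[k] A) (K ⊗[k] B) (θ i)) := by
    rw [List.map_eq_ofFn_get] at hregB
    exact hregB
  -- the multiplicity is small enough because `edim A` is at most the dimension of `A₁`
  have htwo : ∀ t ≥ 2, ∀ a ∈ (𝒜 t).baseChange K, a ∈ Ideal.span (Set.range θ) := by
    intro t ht a ha
    refine mem_span_linear_of_two_le (ℛ := fun i => (𝒜 i).baseChange K)
      (isPositivelyGraded_baseChange K hstd.1) hθ hregA' (fun n => ?_) hmul.2 ?_ ht ha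
    · simp only [finrank_baseChange_piece]
      exact sum_finrank_le_finrank_quotient hstd n
    · rw [finrank_baseChange_piece]
      have : (gradedEmbDim 𝒜 : ℝ) ≤ Module.finrank k (𝒜 1) := by
        exact_mod_cast gradedEmbDim_le hstd
      linarith
  have hhomK : ∀ i, ∀ a ∈ (𝒜 i).baseChange K,
      algebraMap (K ⊗[k] A) (K ⊗[k] B) a ∈ (ℬ i).baseChange K := by
    intro i a ha
    obtain ⟨y, rfl⟩ := Submodule.toBaseChange_surjective' K _ ha
    clear ha
    induction y with
    | zero => simp
    | tmul c a => exact Submodule.tmul_mem_baseChange_of_mem _ (hhom i a a.2)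
    | add y z hy hz =>
      rw [map_add, Submodule.coe_add, map_add]
      exact Submodule.add_mem _ hy hz
  have := finite_of_isIntegral (A := A) hBCM.1 hB
  have := flat_tensorProduct_right k K A
  have := isIntegral_tensorProduct_right k K A
  have : FaithfulSMul A (K ⊗[k] A) := (faithfulSMul_iff_algebraMap_injective _ _).2
    (injective_algebraMap_tensorProduct_right k K A)
  obtain ⟨e⟩ := nonempty_tensorProduct_quotient_range_equiv (k := k) (K := K) (A := A) (B := B)
    fun _ _ => rfl
  refine HasDepth.of_flat (K ⊗[k] A) p ?_ fun P hP hle => ?_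
  · obtain ⟨⟨P, hP⟩, hPp⟩ := Algebra.IsIntegral.comap_surjective A (K ⊗[k] A) ⟨p, hp.isPrime⟩
    intro htop
    refine hP.ne_top (eq_top_iff.2 (htop ▸ Ideal.map_le_iff_le_comap.2 ?_))
    exact (congrArg PrimeSpectrum.asIdeal hPp).ge
  -- the extension is integral, so the primes above `p` are maximal
  · have hcomap : P.comap (algebraMap A (K ⊗[k] A)) = p :=
      (hp.eq_of_le (Ideal.IsPrime.ne_top inferInstance) (Ideal.map_le_iff_le_comap.1 hle)).symm
    have : P.IsMaximal := Ideal.isMaximal_of_isIntegral_of_isMaximal_comap (R := A) P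
      (hcomap.symm ▸ hp)
    exact (hasDepth_quotient_range (K := K) (𝒜 := fun i => (𝒜 i).baseChange K)
      (isPositivelyGraded_baseChange K hB) hhomK hθ hregB' htwo P).congr e.symm

end GradedAlgebra

/-! ### Proper integral extensions of rings of minimal multiplicity -/

theorem mainTheorem7 {k A B : Type*} [Field k] [CommRing A] [CommRing B]
    [Algebra k A] [Algebra k B] [Algebra A B] [IsScalarTower k A B]
    (𝒜 : ℕ → Submodule k A) [GradedAlgebra 𝒜]
    (ℬ : ℕ → Submodule k B) [GradedAlgebra ℬ]
    (hA : IsPositivelyGraded 𝒜) (hB : IsPositivelyGraded ℬ)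
    (hACM : IsCohenMacaulayRing A) (hBCM : IsCohenMacaulayRing B)
    (hinj : Function.Injective (algebraMap A B))
    (hproper : ¬ Function.Surjective (algebraMap A B))
    (hhom : ∀ (i : ℕ), ∀ a ∈ 𝒜 i, algebraMap A B a ∈ ℬ i)
    (hint : Algebra.IsIntegral A B)
    (hstd : IsStandardGraded 𝒜)
    (hmin : HasMinimalMultiplicity 𝒜) :
    IsMaximalCohenMacaulayModule A (B ⧸ LinearMap.range (Algebra.linearMap A B)) := by
  obtain ⟨d, hmul⟩ := hmin
  have := hACM.1
  have := GradedAlgebra.finite_of_isIntegral (A := A) hBCM.1 hB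
  have : Nontrivial (B ⧸ LinearMap.range (Algebra.linearMap A B)) :=
    Submodule.Quotient.nontrivial_iff.2 fun h => hproper (LinearMap.range_eq_top.1 h)
  exact isMaximalCohenMacaulayModule_of_hasDepth hmul.1 fun p _ =>
    GradedAlgebra.hasDepth_quotient_range_of_hasMinimalMultiplicity hB hACM hBCM hinj hhom hstd
      hmul p
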